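/- Let $(\Omega,d,\mu)$ be a space of homogeneous type: $d:\Omega\times\Omega\to[0,\infty)$ is a quasi-metric, i.e. $d(x,y)=0$ if and only if $x=y$, $d(x,y)=d(y,x)$, and $d(x,y)\le A_0\,(d(x,z)+d(z,y))$ for all $x,y,z\in\Omega$, with a constant $A_0>0$; the balls $B(x,r)=\{y\in\Omega: d(x,y)<r\}$, $r>0$, are open in the topology induced by $d$ (a set is open if around each of its points it contains a ball centred at that point); and $\mu$ is a Borel measure on $\Omega$ for which there is a constant $A\ge 1$ such that $0<\mu(B(x,r))\le A\,\mu(B(x,r/2))<\infty$ for all $x\in\Omega$, $r>0$. The Hardy--Littlewood maximal function of a measurable $f:\Omega\to\mathbb{C}$ is $$Mf(x)=\sup_{B\ni x}\frac1{\mu(B)}\int_B|f(y)|\,d\mu(y)\in[0,\infty],$$ the supremum being over all balls $B$ containing $x$. For a measurable function $p(\cdot):\Omega\to(0,\infty]$ let $\Omega_\infty=\{x: p(x)=\infty\}$ and $$m_{p(\cdot)}(f)=\int_{\Omega\setminus\Omega_\infty}|f(x)|^{p(x)}\,d\mu(x)+\operatorname*{ess\,sup}_{x\in\Omega_\infty}|f(x)|.$$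 The variable Lebesgue space $L^{p(\cdot)}(\Omega,d,\mu)$ consists of all measurable $f$ (identified when equal almost everywhere) such that $m_{p(\cdot)}(f/\lambda)<\infty$ for some $\lambda>0$, with the quasi-norm $\|f\|_{p(\cdot)}=\inf\{\lambda>0: m_{p(\cdot)}(f/\lambda)\le1\}$. The operator $M$ is bounded on $L^{p(\cdot)}$ if $Mf\in L^{p(\cdot)}$ for every $f\in L^{p(\cdot)}$ and there is $C<\infty$ with $\|Mf\|_{p(\cdot)}\le C\|f\|_{p(\cdot)}$ for all such $f$; we put $\|M\|_{L^{p(\cdot)}\to L^{p(\cdot)}}=\sup_{f\in L^{p(\cdot)},\,f\neq0}\|Mf\|_{p(\cdot)}/\|f\|_{p(\cdot)}$. Suppose that $p_-:=\operatorname*{ess\,inf}_{x\in\Omega}p(x)>0$. Then the following are equivalent: (1) $M$ is bounded on $L^{p(\cdot)}(\Omega,d,\mu)$. (2) For all $s>1$, $M$ is bounded on $L^{sp(\cdot)}(\Omega,d,\mu)$, and $$\lim_{s\to1^+}(s-1)\,\|M\|_{L^{sp(\cdot)}\to L^{sp(\cdot)}}=0.$$ (3) There exists $r_0\in(0,1)$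 such that $M$ is bounded on $L^{rp(\cdot)}(\Omega,d,\mu)$ for every $r\in[r_0,1)$. -/

import Mathlib

open MeasureTheory Filter Topology
open scoped ENNReal NNReal

namespace HomogeneousType

/-- A quasi-metric: nonnegative, zero exactly on the diagonal, symmetric, and satisfying the
triangle inequality up to a multiplicative constant. -/
structure IsQuasiMetric {Ω : Type*} (d : Ω → Ω → ℝ) : Prop where
  nonneg : ∀ x y, 0 ≤ d x y
  eq_zero_iff : ∀ x y, d x y = 0 ↔ x = y
  symm : ∀ x y, d x y = d y x
  triangle : ∃ A₀ : ℝ, 0 < A₀ ∧ ∀ x y z, d x y ≤ A₀ * (d x z + d z y)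

/-- The ball of `d` with centre `x` and radius `r`. -/
def qball {Ω : Type*} (d : Ω → Ω → ℝ) (x : Ω) (r : ℝ) : Set Ω :=
  {y | d x y < r}

/-- The topology induced by `d`: a set is open if around each of its points it contains a ball
centred at that point. -/
abbrev qtopology {Ω : Type*} (d : Ω → Ω → ℝ) : TopologicalSpace Ω where
  IsOpen G := ∀ x ∈ G, ∃ ε : ℝ, 0 < ε ∧ qball d x ε ⊆ G
  isOpen_univ := fun _ _ => ⟨1, one_pos, Set.subset_univ _⟩
  isOpen_inter := by
    rintro s t hs ht x ⟨hxs, hxt⟩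
    obtain ⟨ε, hε, hεs⟩ := hs x hxs
    obtain ⟨δ, hδ, hδt⟩ := ht x hxt
    refine ⟨min ε δ, lt_min hε hδ, fun y hy => ⟨hεs ?_, hδt ?_⟩⟩
    · exact lt_of_lt_of_le (show d x y < min ε δ from hy) (min_le_left _ _)
    · exact lt_of_lt_of_le (show d x y < min ε δ from hy) (min_le_right _ _)
  isOpen_sUnion := by
    rintro S hS x ⟨t, htS, hxt⟩
    obtain ⟨ε, hε, hεt⟩ := hS t htS x hxt
    exact ⟨ε, hε, hεt.trans (Set.subset_sUnion_of_mem htS)⟩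

/-- `(Ω, d, μ)` is a space of homogeneous type: `d` is a quasi-metric whose balls are open in the
topology it induces, and `μ` is a Borel measure on that topological space which is positive and
finite on balls and doubling. -/
structure IsHomogeneousType {Ω : Type*} [mΩ : MeasurableSpace Ω]
    (d : Ω → Ω → ℝ) (μ : Measure Ω) : Prop where
  quasiMetric : IsQuasiMetric d
  isOpen_qball : ∀ (x : Ω) (r : ℝ), 0 < r → IsOpen[qtopology d] (qball d x r)
  borel_eq : mΩ = @borel Ω (qtopology d)
  doubling : ∃ A : ℝ≥0, 1 ≤ A ∧ ∀ (x : Ω) (r : ℝ), 0 < r →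
    0 < μ (qball d x r) ∧ μ (qball d x r) ≤ A * μ (qball d x (r / 2)) ∧
      A * μ (qball d x (r / 2)) < ∞

/-- The Hardy--Littlewood maximal function of `f`, with values in `[0, ∞]`: the supremum of the
means of `|f|` over all balls (with any centre) that contain the given point. -/
noncomputable def maximal {Ω : Type*} [MeasurableSpace Ω] (d : Ω → Ω → ℝ) (μ : Measure Ω)
    (f : Ω → ℂ) (x : Ω) : ℝ≥0∞ :=
  ⨆ (z : Ω) (r : ℝ) (_ : 0 < r) (_ : x ∈ qball d z r),
    (∫⁻ y in qball d z r, ‖f y‖ₑ ∂μ) / μ (qball d z r)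

/-- An exponent function: a measurable function with values in `(0, ∞]`. -/
structure IsExponent {Ω : Type*} [MeasurableSpace Ω] (p : Ω → ℝ≥0∞) : Prop where
  measurable : Measurable p
  pos : ∀ x, 0 < p x

/-- The modular of the exponent `p`, evaluated at a function which stands for a modulus `|f|`.
It is defined on `[0, ∞]`-valued functions so that it applies to maximal functions too. -/
noncomputable def modular {Ω : Type*} [MeasurableSpace Ω] (μ : Measure Ω) (p : Ω → ℝ≥0∞)
    (g : Ω → ℝ≥0∞) : ℝ≥0∞ :=
  (∫⁻ x in {x | p x ≠ ∞}, g x ^ (p x).toReal ∂μ) + essSup g (μ.restrict {x | p x = ∞})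

/-- `g` has finite modular after division by some positive real number.  If `p > 0` and `g` is
measurable this forces `g < ∞` almost everywhere, so that `g` is then almost everywhere equal to
an element of the variable Lebesgue space. -/
def FiniteModular {Ω : Type*} [MeasurableSpace Ω] (μ : Measure Ω) (p : Ω → ℝ≥0∞)
    (g : Ω → ℝ≥0∞) : Prop :=
  ∃ c : ℝ≥0, 0 < c ∧ modular μ p (fun x => g x / c) < ∞

/-- The variable Lebesgue space `L^{p(·)}(Ω, μ)`, as a set of complex-valued functions. -/
def varLp {Ω : Type*} [MeasurableSpace Ω] (μ : Measure Ω) (p : Ω → ℝ≥0∞) : Set (Ω → ℂ) :=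
  {f | Measurable f ∧ FiniteModular μ p (fun x => ‖f x‖ₑ)}

/-- The Luxemburg--Nakano quasi-norm of a function with modulus `g`, with values in `[0, ∞]`
(the infimum of the empty set being `∞`). -/
noncomputable def luxNorm {Ω : Type*} [MeasurableSpace Ω] (μ : Measure Ω) (p : Ω → ℝ≥0∞)
    (g : Ω → ℝ≥0∞) : ℝ≥0∞ :=
  ⨅ (c : ℝ≥0) (_ : 0 < c) (_ : modular μ p (fun x => g x / c) ≤ 1), (c : ℝ≥0∞)

/-- The maximal operator is bounded on `L^{p(·)}(Ω, d, μ)`: it maps the space to itself, and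
`‖Mf‖ ≤ C ‖f‖` with a finite constant `C` that does not depend on `f`. -/
def MaximalBounded {Ω : Type*} [MeasurableSpace Ω] (d : Ω → Ω → ℝ) (μ : Measure Ω)
    (p : Ω → ℝ≥0∞) : Prop :=
  (∀ f ∈ varLp μ p, FiniteModular μ p (maximal d μ f)) ∧
    ∃ C : ℝ≥0, ∀ f ∈ varLp μ p,
      luxNorm μ p (maximal d μ f) ≤ C * luxNorm μ p (fun x => ‖f x‖ₑ)

/-- The operator quasi-norm of the maximal operator on `L^{p(·)}(Ω, d, μ)`: the supremum of
`‖Mf‖ / ‖f‖` over the elements `f` of the space which are not almost everywhere zero. -/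
noncomputable def maximalNorm {Ω : Type*} [MeasurableSpace Ω] (d : Ω → Ω → ℝ) (μ : Measure Ω)
    (p : Ω → ℝ≥0∞) : ℝ≥0∞ :=
  ⨆ (f : Ω → ℂ) (_ : f ∈ varLp μ p) (_ : ¬ f =ᵐ[μ] 0),
    luxNorm μ p (maximal d μ f) / luxNorm μ p (fun x => ‖f x‖ₑ)

/-- The exponent `s p(·)`, with `s · ∞ = ∞` for `s > 0`. -/
noncomputable def scale {Ω : Type*} (s : ℝ) (p : Ω → ℝ≥0∞) : Ω → ℝ≥0∞ :=
  fun x => ENNReal.ofReal s * p x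

end HomogeneousType

open HomogeneousType

/-! Hölder's inequality gives `(Mg)^s ≤ M(g^s)` for `s ≥ 1`, so a bound for `M` on the exponent `p`
passes to every `s p` with the same constant (`BoundedWith.scale`). This settles (1) → (2), where `s
- 1` multiplies a bounded quantity, and (3) → (1), which only needs the single exponent `r₀ p`.

The substance is (2) → (3), a quantitative form of left-openness (`exists_boundedWith_scale`): if
`M` has bound `B` on the exponent `p`, it is bounded on `p / (1 + δ)` as soon as `δ B` lies below a
constant depending only on the space. Applied to `s p`, this reaches an exponent below `p` once `s -
1` is smaller than a fixed multiple of the inverse of the bound on `s p`, and the limit in (2)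
provides such an `s`.

For the openness, take `h` in the space of exponent `p / (1 + δ)`. Its root `h^(1/(1+δ))` has
exponent `p`, and the Rubio de Francia iteration (`exists_A1_majorant`) majorizes it by a weight `w`
of comparable norm with `Mw ≤ 4B w`. A reverse Hölder inequality (`exists_emaximal_rpow_le`) then
gives `M(w^(1+δ)) ≤ C w^(1+δ)`, hence `Mh ≤ C w^(1+δ)`. That the admissible `δ` is inversely
proportional to the A₁ constant is what matches the rate in (2).

The reverse Hölder inequality is proved on doubling metric spaces by a stopping-radius argument with
a Vitali covering, integration over the levels, and absorption; it is transferred by comparing a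
power of the quasi-metric with a metric. -/

namespace HomogeneousType

/-! ### Unit balls of the modular, and powers of the exponent. -/

section UnitBound

variable {Ω : Type*} [MeasurableSpace Ω] {d : Ω → Ω → ℝ} {μ : Measure Ω} {p : Ω → ℝ≥0∞}
  {g h : Ω → ℝ≥0∞} {c q : ℝ≥0}

/-- The maximal function of a function with values in `[0, ∞]`. -/
noncomputable def emaximal (d : Ω → Ω → ℝ) (μ : Measure Ω) (g : Ω → ℝ≥0∞) (x : Ω) : ℝ≥0∞ :=
  ⨆ (z : Ω) (r : ℝ) (_ : 0 < r) (_ : x ∈ qball d z r),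
    (∫⁻ y in qball d z r, g y ∂μ) / μ (qball d z r)

lemma maximal_eq_emaximal (f : Ω → ℂ) : maximal d μ f = emaximal d μ (fun x => ‖f x‖ₑ) := rfl

lemma emaximal_congr_ae (hgh : g =ᵐ[μ] h) : emaximal d μ g = emaximal d μ h := by
  funext x
  refine iSup_congr fun z => iSup_congr fun r => iSup_congr fun _ => iSup_congr fun _ => ?_
  rw [lintegral_congr_ae (ae_restrict_of_ae hgh)]

lemma emaximal_mono_ae (hgh : g ≤ᵐ[μ] h) : emaximal d μ g ≤ emaximal d μ h := by
  intro x
  refine iSup₂_mono fun z r => iSup₂_mono fun _ _ => ?_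
  gcongr ?_ / _
  exact lintegral_mono_ae (ae_restrict_of_ae hgh)

lemma le_emaximal {x z : Ω} {r : ℝ} (hr : 0 < r) (hx : x ∈ qball d z r) :
    (∫⁻ y in qball d z r, g y ∂μ) / μ (qball d z r) ≤ emaximal d μ g x :=
  le_iSup₂_of_le z r (le_iSup₂_of_le hr hx le_rfl)

lemma emaximal_le {x : Ω} {a : ℝ≥0∞} (ha : ∀ z r, 0 < r → x ∈ qball d z r →
    (∫⁻ y in qball d z r, g y ∂μ) / μ (qball d z r) ≤ a) : emaximal d μ g x ≤ a :=
  iSup₂_le fun z r => iSup₂_le fun hr hx => ha z r hr hx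

/-- The function `g` lies in `c` times the unit ball for the modular in which the sum of the two
terms is replaced by their maximum. -/
def UnitBound (μ : Measure Ω) (p : Ω → ℝ≥0∞) (g : Ω → ℝ≥0∞) (c : ℝ≥0) : Prop :=
  ∫⁻ x in {x | p x ≠ ∞}, (g x / c) ^ (p x).toReal ∂μ ≤ 1 ∧ ∀ᵐ x ∂μ, p x = ∞ → g x ≤ c

/-- The maximal operator maps the elements of the unit ball to elements of norm at most `B`. -/
def BoundedWith (d : Ω → Ω → ℝ) (μ : Measure Ω) (p : Ω → ℝ≥0∞) (B : ℝ≥0) : Prop :=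
  ∀ g : Ω → ℝ≥0∞, Measurable g → ∀ c : ℝ≥0, 0 < c → UnitBound μ p g c →
    UnitBound μ p (emaximal d μ g) (B * c)

lemma IsExponent.toReal_pos (hp : IsExponent p) {x : Ω} (hx : p x ≠ ∞) : 0 < (p x).toReal :=
  ENNReal.toReal_pos (hp.pos x).ne' hx

lemma IsExponent.measurableSet_ne_top (hp : IsExponent p) : MeasurableSet {x | p x ≠ ∞} :=
  (hp.measurable (measurableSet_singleton ∞)).compl

lemma IsExponent.measurableSet_eq_top (hp : IsExponent p) : MeasurableSet {x | p x = ∞} :=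
  hp.measurable (measurableSet_singleton ∞)

lemma UnitBound.mono_ae (hg : UnitBound μ p g c) (hhg : h ≤ᵐ[μ] g) : UnitBound μ p h c := by
  refine ⟨(lintegral_mono_ae ?_).trans hg.1, ?_⟩
  · filter_upwards [ae_restrict_of_ae hhg] with x hx
    gcongr
  · filter_upwards [hhg, hg.2] with x hx hx' hpx using hx.trans (hx' hpx)

lemma UnitBound.mono (hg : UnitBound μ p g c) {c' : ℝ≥0} (hc : c ≤ c') : UnitBound μ p g c' := by
  have hc' : (c : ℝ≥0∞) ≤ c' := by exact_mod_cast hc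
  refine ⟨(lintegral_mono fun x => ?_).trans hg.1, ?_⟩
  · gcongr
  · filter_upwards [hg.2] with x hx hpx using (hx hpx).trans hc'

lemma UnitBound.ae_lt_top (hp : IsExponent p) (hg : UnitBound μ p g c)
    (hgm : Measurable g) : ∀ᵐ x ∂μ, g x < ∞ := by
  have hpm := hp.measurable
  have h1 : ∀ᵐ x ∂μ.restrict {x | p x ≠ ∞}, (g x / c) ^ (p x).toReal < ∞ :=
    MeasureTheory.ae_lt_top (by fun_prop) (hg.1.trans_lt ENNReal.one_lt_top).ne
  rw [ae_restrict_iff' hp.measurableSet_ne_top] at h1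
  filter_upwards [h1, hg.2] with x hx1 hx2
  by_cases hpx : p x = ∞
  · exact (hx2 hpx).trans_lt ENNReal.coe_lt_top
  · by_contra hgx
    have hgt : g x = ∞ := not_lt_top_iff.1 hgx
    have := hx1 hpx
    rw [hgt, ENNReal.top_div_of_ne_top ENNReal.coe_ne_top,
      ENNReal.top_rpow_of_pos (hp.toReal_pos hpx)] at this
    exact this.ne rfl

/-- Since the exponent is at least `q` almost everywhere, dividing by `E ≥ 1` gains at least the
factor `E^(-q)`. -/
lemma lintegral_div_mul_le (hp : IsExponent p) (hq : ∀ᵐ x ∂μ, (q : ℝ≥0∞) ≤ p x)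
    {E : ℝ≥0} (hE : 1 ≤ E) :
    ∫⁻ x in {x | p x ≠ ∞}, (g x / (E * c : ℝ≥0)) ^ (p x).toReal ∂μ
      ≤ ((E : ℝ≥0∞) ^ (q : ℝ))⁻¹ * ∫⁻ x in {x | p x ≠ ∞}, (g x / c) ^ (p x).toReal ∂μ := by
  have hE' : (1 : ℝ≥0∞) ≤ E := by exact_mod_cast hE
  have hE0 : (E : ℝ≥0∞) ≠ 0 := (zero_lt_one.trans_le hE').ne'
  rw [← lintegral_const_mul' _ _ (ENNReal.inv_ne_top.2
    (ENNReal.rpow_pos (pos_iff_ne_zero.2 hE0) ENNReal.coe_ne_top).ne')]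
  refine lintegral_mono_ae ?_
  filter_upwards [ae_restrict_of_ae hq, ae_restrict_mem hp.measurableSet_ne_top] with x hx hpx
  have hqx : (q : ℝ) ≤ (p x).toReal := by
    simpa using ENNReal.toReal_mono hpx hx
  have : g x / (E * c : ℝ≥0) = (E : ℝ≥0∞)⁻¹ * (g x / c) := by
    rw [ENNReal.coe_mul, ENNReal.div_eq_inv_mul, ENNReal.div_eq_inv_mul,
      ENNReal.mul_inv (Or.inl hE0) (Or.inl ENNReal.coe_ne_top), mul_assoc]
  rw [this, ENNReal.mul_rpow_of_nonneg _ _ ENNReal.toReal_nonneg, ENNReal.inv_rpow]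
  gcongr

/-- Turns a bound `m` on the modular into a norm bound, at the price of replacing `m` by about
`m^(1/q)`. The assumption `q ≤ 1` makes the same `E` suffice for the supremum part. -/
lemma unitBound_of_le (hp : IsExponent p) (hq : ∀ᵐ x ∂μ, (q : ℝ≥0∞) ≤ p x) (hq1 : q ≤ 1)
    {m E : ℝ≥0} (hE : 1 ≤ E) (hmE : m ≤ E ^ (q : ℝ))
    (h1 : ∫⁻ x in {x | p x ≠ ∞}, (g x / c) ^ (p x).toReal ∂μ ≤ m)
    (h2 : ∀ᵐ x ∂μ, p x = ∞ → g x ≤ m * c) : UnitBound μ p g (E * c) := by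
  have hE0 : 0 < E := zero_lt_one.trans_le hE
  refine ⟨(lintegral_div_mul_le hp hq hE).trans ?_, ?_⟩
  · rw [ENNReal.inv_mul_le_iff (ENNReal.rpow_pos (by exact_mod_cast hE0) ENNReal.coe_ne_top).ne'
      (ENNReal.rpow_ne_top_of_nonneg q.coe_nonneg ENNReal.coe_ne_top), mul_one,
      ← ENNReal.coe_rpow_of_nonneg _ q.coe_nonneg]
    exact h1.trans (by exact_mod_cast hmE)
  · have hm : m ≤ E := hmE.trans (by
      simpa using NNReal.rpow_le_rpow_of_exponent_le hE (show (q : ℝ) ≤ 1 from hq1))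
    filter_upwards [h2] with x hx hpx
    refine (hx hpx).trans ?_
    rw [ENNReal.coe_mul]
    gcongr

lemma unitBound_of_modular_le (hp : IsExponent p) (hc : 0 < c)
    (h1 : modular μ p (fun x => g x / c) ≤ 1) : UnitBound μ p g c := by
  refine ⟨le_self_add.trans h1, ?_⟩
  have h2 : essSup (fun x => g x / c) (μ.restrict {x | p x = ∞}) ≤ 1 := le_add_self.trans h1
  have h3 := ENNReal.ae_le_essSup (μ := μ.restrict {x | p x = ∞}) (fun x => g x / c)
  rw [ae_restrict_iff' hp.measurableSet_eq_top] at h3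
  filter_upwards [h3] with x hx hpx
  have := (hx hpx).trans h2
  rwa [ENNReal.div_le_iff (by exact_mod_cast hc.ne') ENNReal.coe_ne_top, one_mul] at this

/-- Enlarging the scale by `D` with `D^q ≥ 2` makes each of the two terms at most `1/2`, which pays
for replacing their maximum by their sum. -/
lemma UnitBound.modular_le (hp : IsExponent p) (hq : ∀ᵐ x ∂μ, (q : ℝ≥0∞) ≤ p x) (hq1 : q ≤ 1)
    (hc : 0 < c) {D : ℝ≥0} (hD : 2 ≤ D ^ (q : ℝ)) (hD1 : 1 ≤ D) (hg : UnitBound μ p g c) :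
    modular μ p (fun x => g x / (D * c : ℝ≥0)) ≤ 1 := by
  have hD2 : 2 ≤ D := hD.trans (by
    simpa using NNReal.rpow_le_rpow_of_exponent_le hD1 (show (q : ℝ) ≤ 1 from hq1))
  have hc' : (c : ℝ≥0∞) ≠ 0 := by exact_mod_cast hc.ne'
  have hDc : ((D * c : ℝ≥0) : ℝ≥0∞) ≠ 0 := by
    have : D ≠ 0 := (zero_lt_one.trans_le hD1).ne'
    exact_mod_cast mul_ne_zero this hc.ne'
  rw [modular, ← ENNReal.inv_two_add_inv_two]
  refine add_le_add ?_ ?_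
  · refine (lintegral_div_mul_le hp hq hD1).trans ?_
    calc _ ≤ (2 : ℝ≥0∞)⁻¹ * 1 := by
          gcongr
          · rw [← ENNReal.coe_rpow_of_nonneg _ q.coe_nonneg]
            exact_mod_cast hD
          · exact hg.1
      _ = 2⁻¹ := mul_one _
  · refine essSup_le_of_ae_le _ ?_
    change ∀ᵐ x ∂μ.restrict {x | p x = ∞}, _
    rw [ae_restrict_iff' hp.measurableSet_eq_top]
    filter_upwards [hg.2] with x hx hpx
    rw [ENNReal.div_le_iff hDc ENNReal.coe_ne_top]
    refine (hx hpx).trans ?_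
    have h2 : (2 : ℝ≥0∞) ≤ D := by exact_mod_cast hD2
    calc (c : ℝ≥0∞) = 2⁻¹ * (2 * c) := by
          rw [← mul_assoc, ENNReal.inv_mul_cancel (by simp) (by simp), one_mul]
      _ ≤ 2⁻¹ * (D * c : ℝ≥0) := by rw [ENNReal.coe_mul]; gcongr

lemma two_le_rpow_rpow (hq0 : 0 < q) : (2 : ℝ≥0) ≤ (2 ^ (1 / (q : ℝ))) ^ (q : ℝ) := by
  rw [← NNReal.rpow_mul, one_div, inv_mul_cancel₀ (by exact_mod_cast hq0.ne'), NNReal.rpow_one]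

lemma one_le_two_rpow : (1 : ℝ≥0) ≤ 2 ^ (1 / (q : ℝ)) :=
  NNReal.one_le_rpow one_le_two (by positivity)

lemma finiteModular_iff (hp : IsExponent p) (hq : ∀ᵐ x ∂μ, (q : ℝ≥0∞) ≤ p x) (hq0 : 0 < q)
    (hq1 : q ≤ 1) : FiniteModular μ p g ↔ ∃ c : ℝ≥0, 0 < c ∧ UnitBound μ p g c := by
  constructor
  · rintro ⟨c, hc, hg⟩
    obtain ⟨m, hm⟩ : ∃ m : ℝ≥0, (m : ℝ≥0∞) = modular μ p (fun x => g x / c) :=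
      ⟨_, ENNReal.coe_toNNReal hg.ne⟩
    have h1m : 1 ≤ max m 1 := le_max_right _ _
    have hE : 1 ≤ (max m 1) ^ (1 / (q : ℝ)) := NNReal.one_le_rpow h1m (by positivity)
    refine ⟨(max m 1) ^ (1 / (q : ℝ)) * c, by positivity,
      unitBound_of_le (m := m) hp hq hq1 hE ?_ ?_ ?_⟩
    · rw [← NNReal.rpow_mul, one_div, inv_mul_cancel₀ (by exact_mod_cast hq0.ne'),
        NNReal.rpow_one]
      exact le_max_left _ _
    · rw [hm]; exact le_self_add
    · have h2 : essSup (fun x => g x / c) (μ.restrict {x | p x = ∞}) ≤ m := by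
        rw [hm]; exact le_add_self
      have h3 := ENNReal.ae_le_essSup (μ := μ.restrict {x | p x = ∞}) (fun x => g x / c)
      rw [ae_restrict_iff' hp.measurableSet_eq_top] at h3
      filter_upwards [h3] with x hx hpx
      exact (ENNReal.div_le_iff (by exact_mod_cast hc.ne') ENNReal.coe_ne_top).1 ((hx hpx).trans h2)
  · rintro ⟨c, hc, hg⟩
    have := one_le_two_rpow (q := q)
    exact ⟨2 ^ (1 / (q : ℝ)) * c, by positivity,
      (hg.modular_le hp hq hq1 hc (two_le_rpow_rpow hq0) this).trans_lt ENNReal.one_lt_top⟩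

lemma UnitBound.luxNorm_le (hp : IsExponent p) (hq : ∀ᵐ x ∂μ, (q : ℝ≥0∞) ≤ p x) (hq0 : 0 < q)
    (hq1 : q ≤ 1) (hc : 0 < c) (hg : UnitBound μ p g c) :
    luxNorm μ p g ≤ (2 ^ (1 / (q : ℝ)) * c : ℝ≥0) := by
  have := one_le_two_rpow (q := q)
  exact iInf₂_le_of_le _ (by positivity) (iInf_le_of_le
    (hg.modular_le hp hq hq1 hc (two_le_rpow_rpow hq0) this) le_rfl)

lemma unitBound_of_luxNorm_lt (hp : IsExponent p) (h : luxNorm μ p g < c) : UnitBound μ p g c := by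
  simp only [luxNorm, iInf_lt_iff] at h
  obtain ⟨c', hc', h1, h2⟩ := h
  exact (unitBound_of_modular_le hp hc' h1).mono (by exact_mod_cast h2.le)

lemma MaximalBounded.exists_maximalNorm_le (h : MaximalBounded d μ p) :
    ∃ N : ℝ≥0, maximalNorm d μ p ≤ N := by
  obtain ⟨-, C, hC⟩ := h
  exact ⟨C, iSup₂_le fun f hf => iSup_le fun _ => ENNReal.div_le_of_le_mul (hC f hf)⟩

/-- Boundedness on complex functions gives boundedness on functions with values in `[0, ∞]`. -/
lemma boundedWith_of_maximalNorm_le (hp : IsExponent p) (hq : ∀ᵐ x ∂μ, (q : ℝ≥0∞) ≤ p x)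
    (hq0 : 0 < q) (hq1 : q ≤ 1) {N : ℝ≥0} (hN : maximalNorm d μ p ≤ N) :
    BoundedWith d μ p (N * 2 ^ (1 / (q : ℝ)) + 1) := by
  intro g hg c hc hgc
  set D : ℝ≥0 := 2 ^ (1 / (q : ℝ))
  have hD : 1 ≤ D := one_le_two_rpow
  set f : Ω → ℂ := fun x => ((g x).toReal : ℂ)
  have hfg : (fun x => ‖f x‖ₑ) =ᵐ[μ] g := by
    filter_upwards [hgc.ae_lt_top hp hg] with x hx
    rw [← ofReal_norm, Complex.norm_real, Real.norm_of_nonneg ENNReal.toReal_nonneg,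
      ENNReal.ofReal_toReal hx.ne]
  have hfc : UnitBound μ p (fun x => ‖f x‖ₑ) c := hgc.mono_ae hfg.le
  have hmax : emaximal d μ g = maximal d μ f := (emaximal_congr_ae hfg).symm
  rw [hmax]
  -- The supremum defining the operator norm says nothing about null functions.
  by_cases hf0 : f =ᵐ[μ] 0
  · have h0 : maximal d μ f = 0 := by
      funext x
      have : (fun x => ‖f x‖ₑ) =ᵐ[μ] fun _ => 0 := by
        filter_upwards [hf0] with x hx
        rw [hx]; simp
      rw [maximal_eq_emaximal, emaximal_congr_ae this]
      simp [emaximal]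
    rw [h0]
    refine ⟨?_, Eventually.of_forall fun x _ => zero_le⟩
    refine (lintegral_eq_zero_of_ae_eq_zero ?_).trans_le zero_le_one
    filter_upwards [ae_restrict_mem hp.measurableSet_ne_top] with x hx
    simp [ENNReal.zero_rpow_of_pos (hp.toReal_pos hx)]
  · have hf : f ∈ varLp μ p :=
      ⟨by fun_prop, (finiteModular_iff hp hq hq0 hq1).2 ⟨c, hc, hfc⟩⟩
    refine unitBound_of_luxNorm_lt hp ?_
    have h1 : luxNorm μ p (maximal d μ f) / luxNorm μ p (fun x => ‖f x‖ₑ) ≤ N :=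
      (le_iSup₂_of_le f hf (le_iSup (fun _ : ¬ f =ᵐ[μ] 0 =>
        luxNorm μ p (maximal d μ f) / luxNorm μ p (fun x => ‖f x‖ₑ)) hf0)).trans hN
    have h2 := hfc.luxNorm_le hp hq hq0 hq1 hc
    have h3 : luxNorm μ p (maximal d μ f) / (D * c : ℝ≥0) ≤ N :=
      (ENNReal.div_le_div_left h2 _).trans h1
    have hDc : 0 < D * c := by positivity
    rw [ENNReal.div_le_iff (by exact_mod_cast hDc.ne') ENNReal.coe_ne_top] at h3
    -- The summand `1` in the constant gives strict inequality, so that some admissible scale below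
    -- the claimed one exists even if the infimum is not attained.
    refine h3.trans_lt ?_
    rw [← ENNReal.coe_mul, ENNReal.coe_lt_coe, add_mul, one_mul, mul_assoc]
    exact lt_add_of_pos_right _ hc

lemma BoundedWith.maximalBounded (hp : IsExponent p) (hq : ∀ᵐ x ∂μ, (q : ℝ≥0∞) ≤ p x)
    (hq0 : 0 < q) (hq1 : q ≤ 1) {B : ℝ≥0} (hB0 : 0 < B) (hB : BoundedWith d μ p B) :
    MaximalBounded d μ p ∧ maximalNorm d μ p ≤ (2 ^ (1 / (q : ℝ)) * B : ℝ≥0) := by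
  set D : ℝ≥0 := 2 ^ (1 / (q : ℝ))
  have hD : 1 ≤ D := one_le_two_rpow
  have hDB : 0 < D * B := by positivity
  have key : ∀ f ∈ varLp μ p,
      luxNorm μ p (maximal d μ f) ≤ (D * B : ℝ≥0) * luxNorm μ p (fun x => ‖f x‖ₑ) := by
    rintro f ⟨hf, -⟩
    rw [← ENNReal.div_le_iff' (by exact_mod_cast hDB.ne') ENNReal.coe_ne_top]
    refine le_iInf₂ fun c hc => le_iInf fun hfc => ?_
    rw [ENNReal.div_le_iff' (by exact_mod_cast hDB.ne') ENNReal.coe_ne_top]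
    have := (hB _ hf.enorm c hc (unitBound_of_modular_le hp hc hfc)).luxNorm_le hp hq hq0 hq1
      (by positivity)
    rw [← ENNReal.coe_mul, mul_assoc]
    exact this
  refine ⟨⟨fun f hf => ?_, D * B, key⟩, iSup₂_le fun f hf => iSup_le fun _ =>
    ENNReal.div_le_of_le_mul (key f hf)⟩
  obtain ⟨c, hc, hfc⟩ := (finiteModular_iff hp hq hq0 hq1).1 hf.2
  exact (finiteModular_iff hp hq hq0 hq1).2 ⟨B * c, by positivity, hB _ hf.1.enorm c hc hfc⟩

lemma maximalBounded_iff (hp : IsExponent p) (hq : ∀ᵐ x ∂μ, (q : ℝ≥0∞) ≤ p x)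
    (hq0 : 0 < q) (hq1 : q ≤ 1) :
    MaximalBounded d μ p ↔ ∃ B : ℝ≥0, 1 ≤ B ∧ BoundedWith d μ p B := by
  constructor
  · intro h
    obtain ⟨N, hN⟩ := h.exists_maximalNorm_le
    exact ⟨_, le_add_self, boundedWith_of_maximalNorm_le hp hq hq0 hq1 hN⟩
  · rintro ⟨B, hB1, hB⟩
    exact (hB.maximalBounded hp hq hq0 hq1 (zero_lt_one.trans_le hB1)).1

lemma IsExponent.scale (hp : IsExponent p) {s : ℝ} (hs : 0 < s) : IsExponent (scale s p) where
  measurable := by have := hp.measurable; unfold HomogeneousType.scale; fun_prop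
  pos x := ENNReal.mul_pos (ENNReal.ofReal_pos.2 hs).ne' (hp.pos x).ne'

lemma scale_scale {X : Type*} {p : X → ℝ≥0∞} {s r : ℝ} (hs : 0 ≤ s) :
    scale s (scale r p) = scale (s * r) p := by
  funext x
  simp only [scale]
  rw [ENNReal.ofReal_mul hs, mul_assoc]

/-- This exact power rule is the reason for using the maximum of the two terms: with their sum, the
supremum part would change under the power while the integral would not. -/
lemma unitBound_scale_iff {s : ℝ} (hs : 0 < s) :
    UnitBound μ (scale s p) g c ↔ UnitBound μ p (fun x => g x ^ s) (c ^ s) := by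
  have htop : ∀ x, scale s p x = ∞ ↔ p x = ∞ := fun x => by
    simp [scale, ENNReal.mul_eq_top, hs]
  unfold UnitBound
  simp only [ne_eq, htop]
  refine and_congr ?_ ?_
  · refine iff_of_eq (congrArg (· ≤ 1) (lintegral_congr fun x => ?_))
    rw [ENNReal.coe_rpow_of_nonneg _ hs.le, ← ENNReal.div_rpow_of_nonneg _ _ hs.le,
      ← ENNReal.rpow_mul, scale, ENNReal.toReal_mul, ENNReal.toReal_ofReal hs.le]
  · refine eventually_congr (Eventually.of_forall fun x => ?_)
    rw [ENNReal.coe_rpow_of_nonneg _ hs.le, ENNReal.rpow_le_rpow_iff hs]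

/-- Hölder's inequality for the maximal function. -/
lemma emaximal_rpow_le (hfin : ∀ z r, 0 < r → μ (qball d z r) ≠ 0 ∧ μ (qball d z r) ≠ ∞)
    (hg : Measurable g) {s : ℝ} (hs : 1 ≤ s) (x : Ω) :
    emaximal d μ g x ^ s ≤ emaximal d μ (fun y => g y ^ s) x := by
  have hs0 : 0 < s := zero_lt_one.trans_le hs
  rw [← ENNReal.le_rpow_inv_iff hs0]
  refine emaximal_le fun z r hr hx => ?_
  rw [ENNReal.le_rpow_inv_iff hs0]
  refine le_trans ?_ (le_emaximal hr hx)
  obtain ⟨h0, h1⟩ := hfin z r hr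
  have : Fact (μ (qball d z r) ≠ ∞) := ⟨h1⟩
  set ν : Measure Ω := (μ (qball d z r))⁻¹ • μ.restrict (qball d z r) with hν
  have : IsProbabilityMeasure ν := ⟨by
    rw [hν, Measure.smul_apply, Measure.restrict_apply_univ, smul_eq_mul,
      ENNReal.inv_mul_cancel h0 h1]⟩
  have hint : ∀ f : Ω → ℝ≥0∞,
      (∫⁻ y in qball d z r, f y ∂μ) / μ (qball d z r) = ∫⁻ y, f y ∂ν := fun f => by
    rw [hν, lintegral_smul_measure, smul_eq_mul, ENNReal.div_eq_inv_mul]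
  rw [hint, hint, ← ENNReal.le_rpow_inv_iff hs0]
  have := eLpNorm'_le_eLpNorm'_of_exponent_le (μ := ν) zero_lt_one hs hg.aestronglyMeasurable
  simpa [eLpNorm'] using this

/-- By Hölder, `(Mg)^s` lies below `M(g^s)`, so the constant becomes `B^(1/s)`, which is at most `B`
because `B ≥ 1`. -/
lemma BoundedWith.scale (hfin : ∀ z r, 0 < r → μ (qball d z r) ≠ 0 ∧ μ (qball d z r) ≠ ∞)
    {B : ℝ≥0} (hB1 : 1 ≤ B) (hB : BoundedWith d μ p B) {s : ℝ} (hs : 1 ≤ s) :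
    BoundedWith d μ (scale s p) B := by
  intro g hg c hc hgc
  have hs0 : 0 < s := zero_lt_one.trans_le hs
  rw [unitBound_scale_iff hs0] at hgc ⊢
  refine ((hB _ (hg.pow_const s) _ (NNReal.rpow_pos hc) hgc).mono_ae
    (Eventually.of_forall fun x => emaximal_rpow_le hfin hg hs x)).mono ?_
  rw [NNReal.mul_rpow]
  gcongr
  simpa using NNReal.rpow_le_rpow_of_exponent_le hB1 hs

end UnitBound

/-! ### The reverse Hölder inequality for A₁ weights on doubling metric spaces. -/

/-- A measure on a metric space whose closed balls are of positive finite measure, and which is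
doubling with constant `A` at all scales. -/
structure IsGloballyDoubling {X : Type*} [PseudoMetricSpace X] [MeasurableSpace X]
    (μ : Measure X) (A : ℝ≥0) : Prop where
  pos : ∀ (x : X) (r : ℝ), 0 < r → 0 < μ (Metric.closedBall x r)
  lt_top : ∀ (x : X) (r : ℝ), 0 < r → μ (Metric.closedBall x r) < ∞
  le_mul : ∀ (x : X) (r : ℝ), 0 < r →
    μ (Metric.closedBall x (2 * r)) ≤ A * μ (Metric.closedBall x r)

namespace IsGloballyDoubling

variable {X : Type*} [PseudoMetricSpace X] [MeasurableSpace X] {μ : Measure X} {A : ℝ≥0}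

lemma le_sq_mul (h : IsGloballyDoubling μ A) (x : X) {r : ℝ} (hr : 0 < r) :
    μ (Metric.closedBall x (4 * r)) ≤ A ^ 2 * μ (Metric.closedBall x r) := by
  calc μ (Metric.closedBall x (4 * r)) = μ (Metric.closedBall x (2 * (2 * r))) := by ring_nf
    _ ≤ A * μ (Metric.closedBall x (2 * r)) := h.le_mul x _ (by positivity)
    _ ≤ A * (A * μ (Metric.closedBall x r)) := by gcongr; exact h.le_mul x r hr
    _ = A ^ 2 * μ (Metric.closedBall x r) := by ring

lemma isUnifLocDoublingMeasure (h : IsGloballyDoubling μ A) : IsUnifLocDoublingMeasure μ where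
  exists_measure_closedBall_le_mul'' :=
    ⟨A, by filter_upwards [self_mem_nhdsWithin] with ε hε x using h.le_mul x ε hε⟩

lemma isLocallyFiniteMeasure (h : IsGloballyDoubling μ A) : IsLocallyFiniteMeasure μ where
  finiteAtNhds x := ⟨Metric.closedBall x 1, Metric.closedBall_mem_nhds x one_pos,
    h.lt_top x 1 one_pos⟩

lemma sigmaFinite (h : IsGloballyDoubling μ A) : SigmaFinite μ := by
  rcases isEmpty_or_nonempty X with hX | ⟨⟨x₀⟩⟩
  · rw [Measure.eq_zero_of_isEmpty μ]; infer_instance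
  · refine ⟨⟨⟨fun n => Metric.closedBall x₀ (n + 1), fun _ => trivial,
      fun n => h.lt_top _ _ (by positivity), ?_⟩⟩⟩
    refine Set.eq_univ_of_forall fun y => ?_
    obtain ⟨n, hn⟩ := exists_nat_ge (dist y x₀)
    exact Set.mem_iUnion.2 ⟨n, by rw [Metric.mem_closedBall]; linarith⟩

/-- A σ-finite measure admits only countably many disjoint sets of positive measure. -/
lemma countable_of_pairwiseDisjoint [OpensMeasurableSpace X] (h : IsGloballyDoubling μ A)
    {u : Set X} {r : X → ℝ} (hr : ∀ a ∈ u, 0 < r a)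
    (hd : u.PairwiseDisjoint fun a => Metric.closedBall a (r a)) : u.Countable := by
  have := h.sigmaFinite
  have key := Measure.countable_meas_pos_of_disjoint_iUnion (μ := μ)
    (As := fun a : u => Metric.closedBall (a : X) (r a))
    (fun _ => Metric.isClosed_closedBall.measurableSet)
    (fun a b hab => hd a.2 b.2 (fun e => hab (Subtype.ext e)))
  have huniv : {i : u | 0 < μ (Metric.closedBall (i : X) (r i))} = Set.univ :=
    Set.eq_univ_of_forall fun a => h.pos _ _ (hr a a.2)
  rw [huniv, Set.countable_univ_iff] at key
  exact key

lemma secondCountableTopology [OpensMeasurableSpace X] (h : IsGloballyDoubling μ A) :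
    SecondCountableTopology X := by
  refine Metric.secondCountable_of_almost_dense_set fun ε hε => ?_
  obtain ⟨u, -, hd, hu⟩ := Vitali.exists_disjoint_subfamily_covering_enlargement_closedBall
    (Set.univ : Set X) id (fun _ => ε / 4) (ε / 4) (fun _ _ => le_rfl) 4 (by norm_num)
  refine ⟨u, h.countable_of_pairwiseDisjoint (fun _ _ => by positivity) hd, fun x => ?_⟩
  obtain ⟨b, hb, hxb⟩ := hu x trivial
  refine ⟨b, hb, ?_⟩
  have : dist x b ≤ 4 * (ε / 4) := hxb (Metric.mem_closedBall_self (by positivity))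
  linarith

/-- A form of the Lebesgue differentiation theorem: almost everywhere, a level below the value of
a bounded function is exceeded by its means over small balls. -/
lemma ae_exists_lt_setLIntegral [BorelSpace X] (h : IsGloballyDoubling μ A) {w : X → ℝ≥0∞}
    (hw : Measurable w) {n : ℝ≥0} (hn : ∀ x, w x ≤ n) :
    ∀ᵐ x ∂μ, ∀ (t : ℝ≥0∞) (R : ℝ), t < w x → 0 < R → ∃ k : ℕ,
      t * μ (Metric.closedBall x (R / 4 ^ k)) < ∫⁻ y in Metric.closedBall x (R / 4 ^ k), w y ∂μ := by
  have := h.secondCountableTopology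
  have := h.isLocallyFiniteMeasure
  have := h.isUnifLocDoublingMeasure
  have hfin : ∀ x, w x ≠ ∞ := fun x => ((hn x).trans_lt ENNReal.coe_lt_top).ne
  have hloc : LocallyIntegrable (fun x => (w x).toReal) μ := by
    refine (locallyIntegrable_const (n : ℝ)).mono hw.ennreal_toReal.aestronglyMeasurable ?_
    refine Eventually.of_forall fun x => ?_
    simpa using ENNReal.toReal_mono ENNReal.coe_ne_top (hn x)
  filter_upwards [IsUnifLocDoublingMeasure.ae_tendsto_average μ hloc 1] with x hx t R ht hR
  have hδ : Tendsto (fun k : ℕ => R / 4 ^ k) atTop (𝓝[>] 0) := by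
    refine tendsto_nhdsWithin_iff.2 ⟨?_, Eventually.of_forall fun k => ?_⟩
    · simpa using (tendsto_const_nhds (x := R)).div_atTop
        (tendsto_pow_atTop_atTop_of_one_lt (r := (4 : ℝ)) (by norm_num))
    · exact div_pos hR (by positivity)
  have hlim := hx (fun _ : ℕ => x) _ hδ (Eventually.of_forall fun k =>
    Metric.mem_closedBall_self (by positivity))
  have htop : t ≠ ∞ := ht.ne_top
  have hlt : t.toReal < (w x).toReal := (ENNReal.toReal_lt_toReal htop (hfin x)).2 ht
  obtain ⟨k, hk⟩ := (hlim.eventually (lt_mem_nhds hlt)).exists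
  refine ⟨k, ?_⟩
  set B := Metric.closedBall x (R / 4 ^ k)
  have hrk : 0 < R / 4 ^ k := by positivity
  have hBpos : 0 < μ B := h.pos x _ hrk
  have hBtop : μ B < ∞ := h.lt_top x _ hrk
  have hint : ∫⁻ y in B, w y ∂μ ≠ ∞ := by
    refine ((lintegral_mono hn).trans_lt ?_).ne
    rw [setLIntegral_const]
    exact ENNReal.mul_lt_top ENNReal.coe_lt_top hBtop
  rw [setAverage_eq, integral_toReal hw.aemeasurable
    (Eventually.of_forall fun y => (hfin y).lt_top), smul_eq_mul, inv_mul_eq_div,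
    Measure.real, lt_div_iff₀ (ENNReal.toReal_pos hBpos.ne' hBtop.ne), ← ENNReal.toReal_mul,
    ENNReal.toReal_lt_toReal (ENNReal.mul_ne_top htop hBtop.ne) hint] at hk
  exact hk

variable {w : X → ℝ≥0∞} {n c : ℝ≥0}

/-- The weak type estimate for the level sets of an `A₁` weight. -/
lemma setLIntegral_lt_le [BorelSpace X] (h : IsGloballyDoubling μ A)
    (hw : Measurable w) (hn : ∀ x, w x ≤ n)
    (hA1 : ∀ x z r, 0 < r → x ∈ Metric.closedBall z r →
      ∫⁻ y in Metric.closedBall z r, w y ∂μ ≤ c * w x * μ (Metric.closedBall z r))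
    {z : X} {R : ℝ} (hR : 0 < R) {t : ℝ≥0∞}
    (ht : A ^ 2 * ∫⁻ y in Metric.closedBall z (2 * R), w y ∂μ
      ≤ t * μ (Metric.closedBall z (2 * R))) :
    ∫⁻ y in Metric.closedBall z R ∩ {y | t < w y}, w y ∂μ
      ≤ A ^ 2 * t * μ (Metric.closedBall z (2 * R) ∩ {y | t < c * w y}) := by
  have := h.secondCountableTopology
  let good (x : X) (k : ℕ) : Prop :=
    t * μ (Metric.closedBall x (R / 4 ^ k)) < ∫⁻ y in Metric.closedBall x (R / 4 ^ k), w y ∂μ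
  let G : Set X := (Metric.closedBall z R ∩ {y | t < w y}) ∩ {x | ∃ k, good x k}
  have hGae : (Metric.closedBall z R ∩ {y | t < w y} : Set X) ≤ᵐ[μ] G := by
    filter_upwards [h.ae_exists_lt_setLIntegral hw hn] with x hx hxm
    exact ⟨hxm, hx t R hxm.2 hR⟩
  -- Stopping radius: the first scale `R / 4^k` at which the mean exceeds `t`. The preceding scale,
  -- four times larger, still has mean at most `t`.
  have hrad : ∀ x ∈ G, ∃ r : ℝ, 0 < r ∧ r ≤ R / 4 ∧
      t * μ (Metric.closedBall x r) < ∫⁻ y in Metric.closedBall x r, w y ∂μ ∧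
      ∫⁻ y in Metric.closedBall x (4 * r), w y ∂μ ≤ t * μ (Metric.closedBall x (4 * r)) := by
    classical
    rintro x ⟨⟨hxB, -⟩, hx⟩
    -- The smallness of the mean over the doubled ball in `ht` includes the factor `A ^ 2` lost in
    -- passing to the ball of radius `R` about `x`; so the stopping index is positive.
    have h0 : ¬ good x 0 := by
      simp only [good, pow_zero, div_one, not_lt]
      have hsub : Metric.closedBall x R ⊆ Metric.closedBall z (2 * R) :=
        Metric.closedBall_subset_closedBall' (by
          have := Metric.mem_closedBall.1 hxB; linarith)
      have hsub' : Metric.closedBall z (2 * R) ⊆ Metric.closedBall x (4 * R) :=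
        Metric.closedBall_subset_closedBall' (by
          have := Metric.mem_closedBall'.1 hxB; linarith)
      have hpos := h.pos z (2 * R) (by positivity)
      have hfin := h.lt_top z (2 * R) (by positivity)
      have hle : μ (Metric.closedBall z (2 * R)) ≤ A ^ 2 * μ (Metric.closedBall x R) :=
        (measure_mono hsub').trans (h.le_sq_mul x hR)
      have hA : (A : ℝ≥0∞) ^ 2 ≠ 0 := fun e => by
        rw [e, zero_mul] at hle; exact hpos.not_ge hle
      have hA' : (A : ℝ≥0∞) ^ 2 ≠ ∞ := by simp
      have : A ^ 2 * ∫⁻ y in Metric.closedBall x R, w y ∂μ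
          ≤ A ^ 2 * (t * μ (Metric.closedBall x R)) :=
        calc A ^ 2 * ∫⁻ y in Metric.closedBall x R, w y ∂μ
            ≤ A ^ 2 * ∫⁻ y in Metric.closedBall z (2 * R), w y ∂μ := by
              gcongr
          _ ≤ t * μ (Metric.closedBall z (2 * R)) := ht
          _ ≤ t * (A ^ 2 * μ (Metric.closedBall x R)) := by gcongr
          _ = A ^ 2 * (t * μ (Metric.closedBall x R)) := by ring
      exact (ENNReal.mul_le_mul_iff_right hA hA').1 this
    have hk0 : Nat.find hx ≠ 0 := fun e => h0 (e ▸ Nat.find_spec hx)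
    obtain ⟨j, hj⟩ := Nat.exists_eq_succ_of_ne_zero hk0
    have hspec : good x (j + 1) := by
      have := Nat.find_spec hx
      rwa [hj] at this
    refine ⟨R / 4 ^ (j + 1), by positivity, ?_, hspec, ?_⟩
    · rw [pow_succ]
      gcongr
      have : (1 : ℝ) ≤ 4 ^ j := one_le_pow₀ (by norm_num)
      linarith
    · have hmin := Nat.find_min hx (m := j) (by omega)
      have he : 4 * (R / 4 ^ (j + 1)) = R / 4 ^ j := by rw [pow_succ]; field_simp
      rw [he]
      exact not_lt.1 hmin
  choose! r hr0 hrR hrlt hrle using hrad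
  -- The enlargement factor `4` equals the ratio of consecutive scales, so each enlarged ball is one
  -- on which the mean is at most `t`.
  obtain ⟨u, huG, hd, hu⟩ := Vitali.exists_disjoint_subfamily_covering_enlargement_closedBall
    G id r (R / 4) (fun a ha => hrR a ha) 4 (by norm_num)
  replace hd : u.PairwiseDisjoint fun a => Metric.closedBall a (r a) := hd
  have hucount := h.countable_of_pairwiseDisjoint (fun a ha => hr0 a (huG ha)) hd
  have hcover : G ⊆ ⋃ b ∈ u, Metric.closedBall b (4 * r b) := fun a ha => by
    obtain ⟨b, hb, hab⟩ := hu a ha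
    exact Set.mem_biUnion hb (hab (Metric.mem_closedBall_self (hr0 a ha).le))
  have hinner : (⋃ b ∈ u, Metric.closedBall b (r b))
      ⊆ Metric.closedBall z (2 * R) ∩ {y | t < c * w y} := by
    refine Set.iUnion₂_subset fun b hb y hy => ⟨?_, ?_⟩
    · have h1 := (huG hb).1.1
      have h2 := hrR b (huG hb)
      refine Metric.closedBall_subset_closedBall' ?_ hy
      have := Metric.mem_closedBall.1 h1
      linarith
    · have h1 := (hrlt b (huG hb)).trans_le (hA1 y b (r b) (hr0 b (huG hb)) hy)
      exact lt_of_mul_lt_mul_right' h1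
  calc ∫⁻ y in Metric.closedBall z R ∩ {y | t < w y}, w y ∂μ
      ≤ ∫⁻ y in ⋃ b ∈ u, Metric.closedBall b (4 * r b), w y ∂μ :=
        lintegral_mono_set' (hGae.trans (Eventually.of_forall hcover))
    _ ≤ ∑' b : u, ∫⁻ y in Metric.closedBall (b : X) (4 * r b), w y ∂μ := by
        have := hucount.to_subtype
        rw [Set.biUnion_eq_iUnion]
        exact lintegral_iUnion_le _ _
    _ ≤ ∑' b : u, A ^ 2 * t * μ (Metric.closedBall (b : X) (r b)) := by
        refine ENNReal.tsum_le_tsum fun b => (hrle b (huG b.2)).trans ?_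
        calc t * μ (Metric.closedBall (b : X) (4 * r b))
            ≤ t * (A ^ 2 * μ (Metric.closedBall (b : X) (r b))) := by
              gcongr; exact h.le_sq_mul _ (hr0 b (huG b.2))
          _ = _ := by ring
    _ = A ^ 2 * t * μ (⋃ b ∈ u, Metric.closedBall b (r b)) := by
        rw [ENNReal.tsum_mul_left, measure_biUnion hucount hd
          (fun _ _ => Metric.isClosed_closedBall.measurableSet)]
    _ ≤ _ := by gcongr

/-- Integration of the weak type estimate over all levels. -/
lemma setLIntegral_rpow_le [BorelSpace X] (h : IsGloballyDoubling μ A)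
    (hw : Measurable w) (hn : ∀ x, w x ≤ n)
    (hA1 : ∀ x z r, 0 < r → x ∈ Metric.closedBall z r →
      ∫⁻ y in Metric.closedBall z r, w y ∂μ ≤ c * w x * μ (Metric.closedBall z r))
    {z : X} {R : ℝ} (hR : 0 < R) {T : ℝ≥0}
    (hT : A ^ 2 * ∫⁻ y in Metric.closedBall z (2 * R), w y ∂μ
      ≤ T * μ (Metric.closedBall z (2 * R))) {δ : ℝ} (hδ : 0 < δ) :
    ∫⁻ y in Metric.closedBall z R, w y ^ (1 + δ) ∂μ
      ≤ (T : ℝ≥0∞) ^ δ * ∫⁻ y in Metric.closedBall z R, w y ∂μ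
        + A ^ 2 * ENNReal.ofReal δ * (c : ℝ≥0∞) ^ (1 + δ) *
          ∫⁻ y in Metric.closedBall z (2 * R), w y ^ (1 + δ) ∂μ := by
  set B := Metric.closedBall z R
  set B' := Metric.closedBall z (2 * R)
  have hfin : ∀ x, w x ≠ ∞ := fun x => ((hn x).trans_lt ENNReal.coe_lt_top).ne
  -- Moving one factor `w` into the measure leaves the power `δ`, so the layer-cake formula involves
  -- exactly the quantities of the weak type estimate.
  set ν := (μ.restrict B).withDensity w with hν
  set f : X → ℝ := fun x => (w x).toReal with hf
  have hfm : Measurable f := hw.ennreal_toReal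
  have hwf : ∀ x, w x = ENNReal.ofReal (f x) := fun x => (ENNReal.ofReal_toReal (hfin x)).symm
  have hf0 : ∀ x, 0 ≤ f x := fun x => ENNReal.toReal_nonneg
  have hleft : ∫⁻ y in B, w y ^ (1 + δ) ∂μ = ∫⁻ y, ENNReal.ofReal (f y ^ δ) ∂ν := by
    rw [hν, lintegral_withDensity_eq_lintegral_mul _ hw (by fun_prop)]
    refine lintegral_congr fun y => ?_
    rw [Pi.mul_apply, ← ENNReal.ofReal_rpow_of_nonneg (hf0 y) hδ.le, ← hwf,
      ENNReal.rpow_add_of_nonneg _ _ zero_le_one hδ.le, ENNReal.rpow_one]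
  -- Below `T` the level set is bounded by the whole space, written as a level set of the constant
  -- `T`; from `T` on the weak type estimate applies. Both terms on the right are layer-cake
  -- integrands.
  have hlevel : ∀ s ∈ Set.Ioi (0 : ℝ), ν {a | s < f a} * ENNReal.ofReal (s ^ (δ - 1)) ≤
      ν {_a : X | s < (T : ℝ)} * ENNReal.ofReal (s ^ (δ - 1)) +
      A ^ 2 * (μ.restrict B' {a | s < c * f a} * ENNReal.ofReal (s ^ (1 + δ - 1))) := by
    intro s hs
    have hs0 : 0 < s := hs
    rcases lt_or_ge s T with hsT | hsT
    · exact le_add_right (mul_le_mul' (measure_mono fun a _ => hsT) le_rfl)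
    · refine le_add_left ?_
      have hset : {a | s < f a} = {a | ENNReal.ofReal s < w a} := by
        ext a; simp only [Set.mem_ofPred_eq, hwf a, ENNReal.ofReal_lt_ofReal_iff_of_nonneg hs0.le]
      have hset' : {a | s < c * f a} = {a | ENNReal.ofReal s < c * w a} := by
        ext a
        rw [Set.mem_ofPred_eq, Set.mem_ofPred_eq, hwf a, ← ENNReal.ofReal_coe_nnreal,
          ← ENNReal.ofReal_mul c.coe_nonneg, ENNReal.ofReal_lt_ofReal_iff_of_nonneg hs0.le]
      have hm : MeasurableSet {a | ENNReal.ofReal s < w a} := measurableSet_lt measurable_const hw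
      have hm' : MeasurableSet {a | ENNReal.ofReal s < c * w a} :=
        measurableSet_lt measurable_const (by fun_prop)
      have hTs : (T : ℝ≥0∞) ≤ ENNReal.ofReal s := by
        rw [← ENNReal.ofReal_coe_nnreal]; exact ENNReal.ofReal_le_ofReal hsT
      have key := h.setLIntegral_lt_le hw hn hA1 hR (t := ENNReal.ofReal s)
        (hT.trans (by gcongr))
      rw [hset, hset', hν, withDensity_apply _ hm, Measure.restrict_restrict hm,
        Measure.restrict_apply hm', Set.inter_comm _ B, Set.inter_comm _ B']
      calc _ ≤ A ^ 2 * ENNReal.ofReal s * μ (B' ∩ {y | ENNReal.ofReal s < c * w y}) *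
            ENNReal.ofReal (s ^ (δ - 1)) := by gcongr
        _ = A ^ 2 * (μ (B' ∩ {y | ENNReal.ofReal s < c * w y}) *
            (ENNReal.ofReal s * ENNReal.ofReal (s ^ (δ - 1)))) := by ring
        _ = _ := by
          rw [← ENNReal.ofReal_mul hs0.le, add_sub_assoc, Real.rpow_add hs0, Real.rpow_one]
  have h1δ : 0 < 1 + δ := by positivity
  have hmeas : Measurable fun s : ℝ => ν {_a : X | s < (T : ℝ)} * ENNReal.ofReal (s ^ (δ - 1)) := by
    refine Measurable.mul ?_ (by fun_prop)
    have hanti : Antitone fun s : ℝ => ν {_a : X | s < (T : ℝ)} := fun s s' hss =>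
      measure_mono fun a (ha : s' < T) => lt_of_le_of_lt hss ha
    exact hanti.measurable
  rw [hleft, lintegral_rpow_eq_lintegral_meas_lt_mul ν (Eventually.of_forall hf0)
    hfm.aemeasurable hδ]
  calc ENNReal.ofReal δ * ∫⁻ s in Set.Ioi 0, ν {a | s < f a} * ENNReal.ofReal (s ^ (δ - 1))
      ≤ ENNReal.ofReal δ * ((∫⁻ s in Set.Ioi 0,
            ν {_a : X | s < (T : ℝ)} * ENNReal.ofReal (s ^ (δ - 1))) +
          A ^ 2 * ∫⁻ s in Set.Ioi 0,
            μ.restrict B' {a | s < c * f a} * ENNReal.ofReal (s ^ (1 + δ - 1))) := by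
        gcongr
        rw [← lintegral_const_mul' _ _ (by simp), ← lintegral_add_left hmeas]
        exact setLIntegral_mono' measurableSet_Ioi hlevel
    _ = ENNReal.ofReal δ * (∫⁻ s in Set.Ioi 0,
            ν {_a : X | s < (T : ℝ)} * ENNReal.ofReal (s ^ (δ - 1))) +
          A ^ 2 * ENNReal.ofReal δ * ∫⁻ s in Set.Ioi 0,
            μ.restrict B' {a | s < c * f a} * ENNReal.ofReal (s ^ (1 + δ - 1)) := by ring
    _ ≤ ENNReal.ofReal δ * (∫⁻ s in Set.Ioi 0,
            ν {_a : X | s < (T : ℝ)} * ENNReal.ofReal (s ^ (δ - 1))) +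
          A ^ 2 * ENNReal.ofReal δ * (ENNReal.ofReal (1 + δ) * ∫⁻ s in Set.Ioi 0,
            μ.restrict B' {a | s < c * f a} * ENNReal.ofReal (s ^ (1 + δ - 1))) := by
        gcongr
        exact le_mul_of_one_le_left zero_le (by
          rw [ENNReal.one_le_ofReal]; linarith)
    _ = ∫⁻ _y, ENNReal.ofReal ((T : ℝ) ^ δ) ∂ν +
          A ^ 2 * ENNReal.ofReal δ * ∫⁻ y in B', ENNReal.ofReal ((c * f y) ^ (1 + δ)) ∂μ := by
        rw [← lintegral_rpow_eq_lintegral_meas_lt_mul ν (f := fun _ => (T : ℝ))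
            (Eventually.of_forall fun _ => T.coe_nonneg) aemeasurable_const hδ,
          ← lintegral_rpow_eq_lintegral_meas_lt_mul (μ.restrict B') (f := fun y => c * f y)
            (Eventually.of_forall fun x => mul_nonneg c.coe_nonneg (hf0 x)) (by fun_prop) h1δ]
    _ = _ := by
        congr 1
        · rw [lintegral_const, hν, withDensity_apply _ MeasurableSet.univ,
            Measure.restrict_univ, ← ENNReal.ofReal_rpow_of_nonneg T.coe_nonneg hδ.le,
            ENNReal.ofReal_coe_nnreal]
        · rw [mul_assoc _ ((c : ℝ≥0∞) ^ (1 + δ)), ← lintegral_const_mul' _ _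
            (ENNReal.rpow_ne_top_of_nonneg h1δ.le ENNReal.coe_ne_top)]
          congr 1
          refine lintegral_congr fun y => ?_
          rw [← ENNReal.ofReal_rpow_of_nonneg (mul_nonneg c.coe_nonneg (hf0 y)) h1δ.le,
            ENNReal.ofReal_mul c.coe_nonneg, ENNReal.mul_rpow_of_nonneg _ _ h1δ.le, ← hwf,
            ENNReal.ofReal_coe_nnreal]

/-- From `log c ≤ c` one gets `c^δ ≤ exp (δ c) ≤ e < 3`. -/
lemma rpow_one_add_le {c : ℝ} (hc : 1 ≤ c) {δ : ℝ} (hδ : 0 < δ) (hcδ : δ * c ≤ 1) :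
    c ^ (1 + δ) ≤ 3 * c := by
  have hc0 : 0 < c := by linarith
  rw [Real.rpow_add hc0, Real.rpow_one, mul_comm]
  gcongr
  rw [Real.rpow_def_of_pos hc0]
  have : Real.log c * δ ≤ 1 := by
    have := Real.log_le_self hc0.le
    nlinarith
  have := Real.exp_le_exp.2 this
  have := Real.exp_one_lt_d9
  linarith

/-- The reverse Hölder inequality for bounded `A₁` weights, for exponents whose distance to `1` is
inversely proportional to the `A₁` constant. -/
lemma setLIntegral_rpow_le_of_bounded [BorelSpace X] (h : IsGloballyDoubling μ A)
    (hw : Measurable w) (hn : ∀ x, w x ≤ n) (hA : 1 ≤ A) (hc : 1 ≤ c)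
    (hA1 : ∀ x z r, 0 < r → x ∈ Metric.closedBall z r →
      ∫⁻ y in Metric.closedBall z r, w y ∂μ ≤ c * w x * μ (Metric.closedBall z r))
    {δ : ℝ} (hδ : 0 < δ) (hδc : 6 * (A : ℝ) ^ 3 * δ * c ≤ 1)
    {x z : X} {r : ℝ} (hr : 0 < r) (hx : x ∈ Metric.closedBall z r) :
    ∫⁻ y in Metric.closedBall z r, w y ^ (1 + δ) ∂μ
      ≤ 2 * (A ^ 2 * c * w x) ^ (1 + δ) * μ (Metric.closedBall z r) := by
  have h1δ : 0 < 1 + δ := by positivity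
  have hfin : ∀ x, w x ≠ ∞ := fun x => ((hn x).trans_lt ENNReal.coe_lt_top).ne
  set K : ℝ≥0∞ := (A ^ 2 * c * w x) ^ (1 + δ) with hK
  -- The supremum runs over all balls containing the fixed point `x`, a family stable under
  -- doubling; hence the doubled ball in the level estimate can be absorbed.
  set S : ℝ≥0∞ := ⨆ (z : X) (r : ℝ) (_ : 0 < r) (_ : x ∈ Metric.closedBall z r),
    (∫⁻ y in Metric.closedBall z r, w y ^ (1 + δ) ∂μ) / μ (Metric.closedBall z r) with hS
  have hle : ∀ z r, 0 < r → x ∈ Metric.closedBall z r →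
      ∫⁻ y in Metric.closedBall z r, w y ^ (1 + δ) ∂μ ≤ S * μ (Metric.closedBall z r) := by
    intro z r hr hx
    rw [← ENNReal.div_le_iff (h.pos z r hr).ne' (h.lt_top z r hr).ne]
    exact le_iSup₂_of_le z r (le_iSup₂_of_le hr hx le_rfl)
  -- Boundedness of `w` serves to make `S` finite, without which absorption would be void; the final
  -- bound does not involve `n`.
  have hStop : S ≠ ∞ := by
    refine ne_top_of_le_ne_top (ENNReal.rpow_ne_top_of_nonneg h1δ.le (ENNReal.coe_ne_top (r := n)))
      (iSup₂_le fun z r => iSup₂_le fun hr _ => ?_)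
    rw [ENNReal.div_le_iff (h.pos z r hr).ne' (h.lt_top z r hr).ne, ← setLIntegral_const]
    exact lintegral_mono fun y => by gcongr; exact hn y
  have hA1' : (1 : ℝ) ≤ A := hA
  have hc1' : (1 : ℝ) ≤ c := hc
  have hA3 : (1 : ℝ) ≤ (A : ℝ) ^ 3 := one_le_pow₀ hA1'
  have hδc1 : δ * c ≤ 1 := by nlinarith [mul_pos hδ (zero_lt_one.trans_le hc1')]
  -- Two factors `A` come from the weak type estimate, the third from doubling the ball. With
  -- `c^(1+δ) ≤ 3c`, the factor `6` in `hδc` yields `1/2`.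
  have hθ : (A : ℝ≥0∞) ^ 3 * ENNReal.ofReal δ * (c : ℝ≥0∞) ^ (1 + δ) ≤ 2⁻¹ := by
    rw [← ENNReal.ofReal_coe_nnreal, ← ENNReal.ofReal_coe_nnreal (p := c),
      ENNReal.ofReal_rpow_of_nonneg c.coe_nonneg h1δ.le, ← ENNReal.ofReal_pow A.coe_nonneg,
      ← ENNReal.ofReal_mul (by positivity), ← ENNReal.ofReal_mul (by positivity)]
    refine (ENNReal.ofReal_le_ofReal (q := 1 / 2) ?_).trans_eq (by
      rw [one_div, ENNReal.ofReal_inv_of_pos (by norm_num)]; simp)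
    calc (A : ℝ) ^ 3 * δ * (c : ℝ) ^ (1 + δ) ≤ (A : ℝ) ^ 3 * δ * (3 * c) := by
          gcongr; exact rpow_one_add_le hc1' hδ hδc1
      _ ≤ 1 / 2 := by linarith
  have hmain : S ≤ K + 2⁻¹ * S := by
    refine iSup₂_le fun z r => iSup₂_le fun hr hx => ?_
    rw [ENNReal.div_le_iff (h.pos z r hr).ne' (h.lt_top z r hr).ne]
    have hx2 : x ∈ Metric.closedBall z (2 * r) :=
      Metric.closedBall_subset_closedBall (by linarith) hx
    obtain ⟨T, hT⟩ : ∃ T : ℝ≥0, (T : ℝ≥0∞) = A ^ 2 * c * w x :=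
      ⟨(A ^ 2 * c * w x).toNNReal, ENNReal.coe_toNNReal
        (ENNReal.mul_ne_top (by finiteness) (hfin x))⟩
    have key := h.setLIntegral_rpow_le hw hn hA1 hr (T := T) (by
      rw [hT]
      calc _ ≤ A ^ 2 * (c * w x * μ (Metric.closedBall z (2 * r))) := by
            gcongr; exact hA1 x z _ (by positivity) hx2
        _ = _ := by ring) hδ
    refine key.trans ?_
    rw [add_mul]
    refine add_le_add ?_ ?_
    · calc (T : ℝ≥0∞) ^ δ * ∫⁻ y in Metric.closedBall z r, w y ∂μ
          ≤ (T : ℝ≥0∞) ^ δ * (T * μ (Metric.closedBall z r)) := by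
            gcongr
            refine (hA1 x z r hr hx).trans ?_
            have hA2 : (1 : ℝ≥0∞) ≤ (A : ℝ≥0∞) ^ 2 := one_le_pow₀ (by exact_mod_cast hA)
            rw [hT, mul_assoc ((A : ℝ≥0∞) ^ 2), mul_assoc ((A : ℝ≥0∞) ^ 2)]
            exact le_mul_of_one_le_left zero_le hA2
        _ = K * μ (Metric.closedBall z r) := by
            rw [hK, ← hT, ENNReal.rpow_add_of_nonneg _ _ zero_le_one hδ.le, ENNReal.rpow_one]
            ring
    · calc _ ≤ A ^ 2 * ENNReal.ofReal δ * (c : ℝ≥0∞) ^ (1 + δ) *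
            (S * (A * μ (Metric.closedBall z r))) := by
            gcongr
            refine (hle z _ (by positivity) hx2).trans ?_
            gcongr
            exact h.le_mul z r hr
        _ = A ^ 3 * ENNReal.ofReal δ * (c : ℝ≥0∞) ^ (1 + δ) * (S * μ (Metric.closedBall z r)) := by
            ring
        _ ≤ 2⁻¹ * (S * μ (Metric.closedBall z r)) := by gcongr
        _ = _ := by ring
  have hSK : S ≤ 2 * K := by
    have h2 : 2⁻¹ * S + 2⁻¹ * S ≤ K + 2⁻¹ * S := by
      rw [← add_mul, ENNReal.inv_two_add_inv_two, one_mul]; exact hmain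
    have h3 : 2⁻¹ * S ≤ K := (ENNReal.add_le_add_iff_right (by finiteness)).1 h2
    calc S = 2 * (2⁻¹ * S) := by
          rw [← mul_assoc, ENNReal.mul_inv_cancel (by simp) (by simp), one_mul]
      _ ≤ 2 * K := by gcongr
  exact (hle z r hr hx).trans (by gcongr)

/-- The reverse Hölder inequality for `A₁` weights, for exponents whose distance to `1` is
inversely proportional to the `A₁` constant. -/
theorem setLIntegral_rpow_le_of_A1 [BorelSpace X] (h : IsGloballyDoubling μ A)
    (hw : Measurable w) (hA : 1 ≤ A) (hc : 1 ≤ c)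
    (hA1 : ∀ x z r, 0 < r → x ∈ Metric.closedBall z r →
      ∫⁻ y in Metric.closedBall z r, w y ∂μ ≤ c * w x * μ (Metric.closedBall z r))
    {δ : ℝ} (hδ : 0 < δ) (hδc : 6 * (A : ℝ) ^ 3 * δ * c ≤ 1)
    {x z : X} {r : ℝ} (hr : 0 < r) (hx : x ∈ Metric.closedBall z r) :
    ∫⁻ y in Metric.closedBall z r, w y ^ (1 + δ) ∂μ
      ≤ 2 * (A ^ 2 * c * w x) ^ (1 + δ) * μ (Metric.closedBall z r) := by
  have h1δ : 0 < 1 + δ := by positivity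
  have hsup : ∀ y, w y ^ (1 + δ) = ⨆ n : ℕ, (min (w y) n) ^ (1 + δ) := fun y => by
    have e : w y = ⨆ n : ℕ, min (w y) n := by
      rw [← inf_iSup_eq, ENNReal.iSup_natCast, inf_top_eq]
    conv_lhs => rw [e]
    exact (ENNReal.orderIsoRpow (1 + δ) h1δ).map_iSup _
  have hmono : Monotone fun (n : ℕ) (y : X) => (min (w y) n) ^ (1 + δ) := fun n m hnm y => by
    dsimp only
    gcongr
  simp_rw [hsup]
  rw [lintegral_iSup (fun n => by fun_prop) hmono]
  refine iSup_le fun n => ?_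
  have key := h.setLIntegral_rpow_le_of_bounded (w := fun y => min (w y) n) (n := n) (c := c)
    (by fun_prop) (fun y => by simp) hA hc (fun x z r hr hx => ?_) hδ hδc hr hx
  · refine key.trans ?_
    gcongr
    exact min_le_left _ _
  -- Truncation preserves the A₁ condition with the same constant, as `c ≥ 1`.
  · rcases le_total (w x) n with hxn | hxn
    · rw [min_eq_left hxn]
      exact (lintegral_mono fun y => min_le_left _ _).trans (hA1 x z r hr hx)
    · rw [min_eq_right hxn]
      calc ∫⁻ y in Metric.closedBall z r, min (w y) n ∂μ
          ≤ ∫⁻ _y in Metric.closedBall z r, (n : ℝ≥0∞) ∂μ := lintegral_mono fun y => min_le_right _ _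
        _ = 1 * n * μ (Metric.closedBall z r) := by rw [setLIntegral_const, one_mul]
        _ ≤ _ := by gcongr; exact_mod_cast hc

end IsGloballyDoubling

/-! ### Metrization of a power of a quasi-metric. -/

section Geometry

variable {Ω : Type*} {d : Ω → Ω → ℝ}

/-- A power of a quasi-metric is comparable to a metric. -/
lemma IsQuasiMetric.exists_dist (hd : IsQuasiMetric d) :
    ∃ (I : PseudoMetricSpace Ω) (α : ℝ), 0 < α ∧
      ∀ x y, I.dist x y ≤ d x y ^ α ∧ d x y ^ α ≤ 2 * I.dist x y := by
  obtain ⟨A₀, hA₀, htri⟩ := hd.triangle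
  set L : ℝ := 2 * A₀ + 2 with hL
  have hL2 : 2 ≤ L := by linarith
  have htriL : ∀ x y z, d x y ≤ L * max (d x z) (d z y) := fun x y z => by
    have h1 := le_max_left (d x z) (d z y)
    have h2 := le_max_right (d x z) (d z y)
    have h0 := (hd.nonneg x z).trans h1
    nlinarith [htri x y z, mul_le_mul_of_nonneg_left (add_le_add h1 h2) hA₀.le]
  have hquad : ∀ x₁ x₂ x₃ x₄,
      d x₁ x₄ ≤ L ^ 2 * max (d x₁ x₂) (max (d x₂ x₃) (d x₃ x₄)) := fun x₁ x₂ x₃ x₄ => by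
    set m := max (d x₁ x₂) (max (d x₂ x₃) (d x₃ x₄))
    have h1 : d x₁ x₂ ≤ m := le_max_left _ _
    have h2 : max (d x₂ x₃) (d x₃ x₄) ≤ m := le_max_right _ _
    have h0 : 0 ≤ m := (hd.nonneg _ _).trans h1
    calc d x₁ x₄ ≤ L * max (d x₁ x₂) (d x₂ x₄) := htriL _ _ _
      _ ≤ L * (L * m) := by
        gcongr
        refine max_le (by nlinarith) ((htriL _ _ x₃).trans (by gcongr))
      _ = L ^ 2 * m := by ring
  -- This power turns the constant `L ^ 2` of the four-point inequality into `2`, the value for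
  -- which the chain construction gives a comparable pseudometric.
  set α : ℝ := Real.log 2 / Real.log (L ^ 2) with hα
  have hL4 : 1 < L ^ 2 := by nlinarith
  have hlog : 0 < Real.log (L ^ 2) := Real.log_pos hL4
  have hα0 : 0 < α := div_pos (Real.log_pos one_lt_two) hlog
  have hLα : (L ^ 2) ^ α = 2 := by
    rw [Real.rpow_def_of_pos (by positivity), hα, mul_div_cancel₀ _ hlog.ne',
      Real.exp_log two_pos]
  let D : Ω → Ω → ℝ≥0 := fun x y => ⟨d x y ^ α, Real.rpow_nonneg (hd.nonneg x y) α⟩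
  have hself : ∀ x, D x x = 0 := fun x => by
    refine NNReal.coe_injective ?_
    change d x x ^ α = 0
    rw [(hd.eq_zero_iff x x).2 rfl, Real.zero_rpow hα0.ne']
  have hcomm : ∀ x y, D x y = D y x := fun x y => by
    refine NNReal.coe_injective ?_
    change d x y ^ α = d y x ^ α
    rw [hd.symm]
  have hD : ∀ x₁ x₂ x₃ x₄,
      D x₁ x₄ ≤ 2 * max (D x₁ x₂) (max (D x₂ x₃) (D x₃ x₄)) := fun x₁ x₂ x₃ x₄ => by
    rw [← NNReal.coe_le_coe]
    push_cast
    change d x₁ x₄ ^ α ≤ 2 * max (d x₁ x₂ ^ α) (max (d x₂ x₃ ^ α) (d x₃ x₄ ^ α))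
    have hmono : MonotoneOn (fun t : ℝ => t ^ α) (Set.Ici 0) :=
      Real.monotoneOn_rpow_Ici_of_exponent_nonneg hα0.le
    have h12 := hd.nonneg x₁ x₂
    have h23 := hd.nonneg x₂ x₃
    have h34 := hd.nonneg x₃ x₄
    have e1 : max (d x₂ x₃ ^ α) (d x₃ x₄ ^ α) = (max (d x₂ x₃) (d x₃ x₄)) ^ α :=
      (hmono.map_max h23 h34).symm
    have e2 : max (d x₁ x₂ ^ α) ((max (d x₂ x₃) (d x₃ x₄)) ^ α)
        = (max (d x₁ x₂) (max (d x₂ x₃) (d x₃ x₄))) ^ α :=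
      (hmono.map_max h12 (h23.trans (le_max_left _ _))).symm
    rw [e1, e2, ← hLα, ← Real.mul_rpow (by positivity) (h12.trans (le_max_left _ _))]
    exact Real.rpow_le_rpow (hd.nonneg _ _) (hquad _ _ _ _) hα0.le
  exact ⟨PseudoMetricSpace.ofPreNNDist D hself hcomm, α, hα0, fun x y =>
    ⟨PseudoMetricSpace.dist_ofPreNNDist_le D hself hcomm x y,
      PseudoMetricSpace.le_two_mul_dist_ofPreNNDist D hself hcomm hD x y⟩⟩

end Geometry

/-! ### Reverse Hölder inequality on spaces of homogeneous type. -/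

variable {Ω : Type*} [mΩ : MeasurableSpace Ω] {d : Ω → Ω → ℝ} {μ : Measure Ω}

lemma IsHomogeneousType.measure_qball (hΩ : IsHomogeneousType d μ) (z : Ω) (r : ℝ) (hr : 0 < r) :
    μ (qball d z r) ≠ 0 ∧ μ (qball d z r) ≠ ∞ := by
  obtain ⟨A, -, hA⟩ := hΩ.doubling
  obtain ⟨h1, h2, h3⟩ := hA z r hr
  exact ⟨h1.ne', (h2.trans_lt h3).ne⟩

/-- The maximal function is lower semicontinuous, because balls are open; no measurability of `g`
enters. -/
lemma IsHomogeneousType.measurable_emaximal (hΩ : IsHomogeneousType d μ) (g : Ω → ℝ≥0∞) :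
    Measurable (emaximal d μ g) := by
  have hopen : ∀ G : Set Ω, IsOpen[qtopology d] G → MeasurableSet G := fun G hG => by
    rw [hΩ.borel_eq]
    exact MeasurableSpace.measurableSet_generateFrom hG
  refine measurable_of_Ioi fun t => hopen _ fun x hx => ?_
  have hx' : t < emaximal d μ g x := hx
  simp only [emaximal, lt_iSup_iff] at hx'
  obtain ⟨z, r, hr, hxz, ht⟩ := hx'
  obtain ⟨ε, hε, hsub⟩ := hΩ.isOpen_qball z r hr x hxz
  exact ⟨ε, hε, fun y hy => ht.trans_le (le_emaximal hr (hsub hy))⟩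

lemma IsHomogeneousType.exists_measure_qball_mul_le (hΩ : IsHomogeneousType d μ) (a : ℝ) :
    ∃ A : ℝ≥0, 1 ≤ A ∧ ∀ (x : Ω) (r : ℝ), 0 < r →
      μ (qball d x (a * r)) ≤ A * μ (qball d x r) := by
  obtain ⟨A, hA1, hA⟩ := hΩ.doubling
  obtain ⟨m, hm⟩ := pow_unbounded_of_one_lt a one_lt_two
  have hpow : ∀ (k : ℕ) (x : Ω) (r : ℝ), 0 < r →
      μ (qball d x (2 ^ k * r)) ≤ (A : ℝ≥0∞) ^ k * μ (qball d x r) := by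
    intro k x r hr
    induction k with
    | zero => simp
    | succ k ih =>
      have h2 := (hA x (2 ^ (k + 1) * r) (by positivity)).2.1
      rw [show (2 : ℝ) ^ (k + 1) * r / 2 = 2 ^ k * r by rw [pow_succ]; ring] at h2
      calc _ ≤ (A : ℝ≥0∞) * (A ^ k * μ (qball d x r)) := h2.trans (by gcongr)
        _ = _ := by ring
  refine ⟨A ^ m, one_le_pow₀ hA1, fun x r hr => ?_⟩
  rw [ENNReal.coe_pow]
  refine le_trans (measure_mono fun y hy => ?_) (hpow m x r hr)
  exact lt_of_lt_of_le (show d x y < a * r from hy) (by gcongr)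

/-- The reverse Hölder inequality for `A₁` weights on a space of homogeneous type. -/
theorem IsHomogeneousType.exists_emaximal_rpow_le (hΩ : IsHomogeneousType d μ) :
    ∃ ε : ℝ, 0 < ε ∧ ∀ (c : ℝ≥0), 1 ≤ c → ∀ δ : ℝ, 0 < δ → δ * c ≤ ε → ∃ C : ℝ≥0, 1 ≤ C ∧
      ∀ w : Ω → ℝ≥0∞, Measurable w → (∀ x, emaximal d μ w x ≤ c * w x) →
        ∀ x, emaximal d μ (fun y => w y ^ (1 + δ)) x ≤ C * w x ^ (1 + δ) := by
  have hd := hΩ.quasiMetric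
  obtain ⟨I, α, hα, hI⟩ := hd.exists_dist
  -- A closed metric ball of radius `2 r` lies in the quasi-ball of radius `(6 r)^(1/α)`:
  -- comparability costs `2`, raised to `3` because quasi-balls are strict.
  obtain ⟨A, hA1, hA⟩ := hΩ.exists_measure_qball_mul_le (6 ^ α⁻¹)
  have hsub1 : ∀ x r, 0 < r → Metric.closedBall x r ⊆ qball d x ((3 * r) ^ α⁻¹) := by
    intro x r hr y hy
    have h1 := (hI x y).2
    have h2 : dist x y ≤ r := Metric.mem_closedBall'.1 hy
    have h3 : d x y ^ α < 3 * r := by linarith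
    exact (Real.lt_rpow_inv_iff_of_pos (hd.nonneg x y) (by positivity) hα).2 h3
  have hsub2 : ∀ x r, 0 < r → qball d x (r ^ α⁻¹) ⊆ Metric.ball x r := by
    intro x r hr y hy
    have h1 : dist x y ≤ d x y ^ α := (hI x y).1
    exact Metric.mem_ball'.2 (h1.trans_lt
      ((Real.lt_rpow_inv_iff_of_pos (hd.nonneg x y) hr.le hα).1 hy))
  have hmeas : ∀ x r, 0 < r →
      μ (qball d x ((6 * r) ^ α⁻¹)) ≤ A * μ (qball d x (r ^ α⁻¹)) := by
    intro x r hr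
    rw [Real.mul_rpow (by norm_num) hr.le]
    exact hA x _ (by positivity)
  have hqmono : ∀ (x : Ω) {r s : ℝ}, r ≤ s → qball d x r ⊆ qball d x s :=
    fun x r s hrs y hy => lt_of_lt_of_le (show d x y < r from hy) hrs
  have hball : ∀ (x : Ω) (r : ℝ), Metric.ball x r ⊆ Metric.closedBall x r :=
    fun _ _ => Metric.ball_subset_closedBall
  have htop : I.toUniformSpace.toTopologicalSpace = qtopology d := by
    refine TopologicalSpace.ext_iff.2 fun G => ?_
    rw [Metric.isOpen_iff]
    refine forall₂_congr fun x _ => ⟨?_, ?_⟩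
    · rintro ⟨ε, hε, h⟩
      exact ⟨ε ^ α⁻¹, by positivity, (hsub2 x ε hε).trans h⟩
    · rintro ⟨ε, hε, h⟩
      have hε' : 0 < ε ^ α / 3 := by positivity
      refine ⟨ε ^ α / 3, hε', (hball _ _).trans ((hsub1 x _ hε').trans ?_)⟩
      rwa [mul_div_cancel₀ _ (by norm_num), Real.rpow_rpow_inv hε.le hα.ne']
  have hborel : BorelSpace Ω := ⟨by rw [htop]; exact hΩ.borel_eq⟩
  have hdoub : IsGloballyDoubling μ A := by
    refine ⟨fun x r hr => ?_, fun x r hr => ?_, fun x r hr => ?_⟩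
    · exact (pos_iff_ne_zero.2 (hΩ.measure_qball x (r ^ α⁻¹) (by positivity)).1).trans_le
        (measure_mono ((hsub2 x r hr).trans (hball x r)))
    · exact (measure_mono (hsub1 x r hr)).trans_lt
        (hΩ.measure_qball x _ (by positivity)).2.lt_top
    · calc μ (Metric.closedBall x (2 * r)) ≤ μ (qball d x ((3 * (2 * r)) ^ α⁻¹)) :=
            measure_mono (hsub1 x _ (by positivity))
        _ = μ (qball d x ((6 * r) ^ α⁻¹)) := by ring_nf
        _ ≤ A * μ (qball d x (r ^ α⁻¹)) := hmeas x r hr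
        _ ≤ A * μ (Metric.closedBall x r) := by
            gcongr; exact (hsub2 x r hr).trans (hball x r)
  have hA1' : (1 : ℝ) ≤ A := hA1
  -- The fourth factor `A` arises because the A₁ constant over metric balls is `A * c`.
  refine ⟨1 / (6 * (A : ℝ) ^ 4), by positivity, fun c hc δ hδ hδc =>
    ⟨2 * (A ^ 2 * (A * c)) ^ (1 + δ) * A, ?_, fun w hw hwA x => ?_⟩⟩
  · have h1 : 1 ≤ A ^ 2 * (A * c) :=
      one_le_mul (one_le_pow₀ hA1) (one_le_mul hA1 hc)
    exact one_le_mul (one_le_mul one_le_two (NNReal.one_le_rpow h1 (by positivity))) hA1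
  refine emaximal_le fun z t ht hx => ?_
  obtain ⟨hq0, hq1⟩ := hΩ.measure_qball z t ht
  rw [ENNReal.div_le_iff hq0 hq1]
  have hr : 0 < t ^ α := by positivity
  have htα : (t ^ α) ^ α⁻¹ = t := Real.rpow_rpow_inv ht.le hα.ne'
  have hsub : qball d z t ⊆ Metric.closedBall z (t ^ α) := by
    have := (hsub2 z _ hr).trans (hball z _)
    rwa [htα] at this
  have hA1w : ∀ x z r, 0 < r → x ∈ Metric.closedBall z r →
      ∫⁻ y in Metric.closedBall z r, w y ∂μ
        ≤ (A * c : ℝ≥0) * w x * μ (Metric.closedBall z r) := by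
    intro x z r hr hx
    have hs : 0 < (3 * r) ^ α⁻¹ := by positivity
    obtain ⟨h0, h1⟩ := hΩ.measure_qball z _ hs
    have hM := (le_emaximal (g := w) (μ := μ) hs (hsub1 z r hr hx)).trans (hwA x)
    rw [ENNReal.div_le_iff h0 h1] at hM
    calc ∫⁻ y in Metric.closedBall z r, w y ∂μ
        ≤ ∫⁻ y in qball d z ((3 * r) ^ α⁻¹), w y ∂μ := lintegral_mono_set (hsub1 z r hr)
      _ ≤ c * w x * μ (qball d z ((3 * r) ^ α⁻¹)) := hM
      _ ≤ c * w x * μ (qball d z ((6 * r) ^ α⁻¹)) := by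
          gcongr
          exact hqmono z (by gcongr; norm_num)
      _ ≤ c * w x * (A * μ (qball d z (r ^ α⁻¹))) := by gcongr; exact hmeas z r hr
      _ ≤ c * w x * (A * μ (Metric.closedBall z r)) := by
          gcongr; exact (hsub2 z r hr).trans (hball z r)
      _ = _ := by rw [ENNReal.coe_mul]; ring
  have hδc' : 6 * (A : ℝ) ^ 3 * δ * (A * c : ℝ≥0) ≤ 1 := by
    rw [le_div_iff₀ (by positivity)] at hδc
    push_cast
    linarith
  have key := hdoub.setLIntegral_rpow_le_of_A1 hw hA1 (one_le_mul hA1 hc) hA1w hδ hδc' hr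
    (hsub hx)
  have hle : μ (Metric.closedBall z (t ^ α)) ≤ A * μ (qball d z t) := by
    calc μ (Metric.closedBall z (t ^ α)) ≤ μ (qball d z ((3 * t ^ α) ^ α⁻¹)) :=
          measure_mono (hsub1 z _ hr)
      _ ≤ μ (qball d z ((6 * t ^ α) ^ α⁻¹)) :=
          measure_mono (hqmono z (by gcongr; norm_num))
      _ ≤ A * μ (qball d z t) := by have := hmeas z _ hr; rwa [htα] at this
  have h1δ : 0 ≤ 1 + δ := by positivity
  calc ∫⁻ y in qball d z t, w y ^ (1 + δ) ∂μ
      ≤ ∫⁻ y in Metric.closedBall z (t ^ α), w y ^ (1 + δ) ∂μ := lintegral_mono_set hsub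
    _ ≤ _ := key
    _ ≤ 2 * (A ^ 2 * (A * c : ℝ≥0) * w x) ^ (1 + δ) * (A * μ (qball d z t)) := by gcongr
    _ = _ := by
      rw [ENNReal.mul_rpow_of_nonneg _ _ h1δ]
      simp only [ENNReal.coe_mul, ENNReal.coe_rpow_of_nonneg _ h1δ, ENNReal.coe_pow,
        ENNReal.coe_ofNat]
      ring

/-! ### Rubio de Francia iteration and self-improvement of the exponent. -/

variable {p : Ω → ℝ≥0∞} {q : ℝ≥0}

/-- The Rubio de Francia algorithm: a function in a space on which the maximal operator is bounded
has a majorant of comparable norm which is an `A₁` weight. -/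
lemma IsHomogeneousType.exists_A1_majorant (hΩ : IsHomogeneousType d μ) (hp : IsExponent p)
    (hq : ∀ᵐ x ∂μ, (q : ℝ≥0∞) ≤ p x) (hq0 : 0 < q) (hq1 : q ≤ 1) {B : ℝ≥0} (hB1 : 1 ≤ B)
    (hB : BoundedWith d μ p B) :
    ∃ C : ℝ≥0, 1 ≤ C ∧ ∀ g : Ω → ℝ≥0∞, Measurable g → ∀ c : ℝ≥0, 0 < c → UnitBound μ p g c →
      ∃ w : Ω → ℝ≥0∞, Measurable w ∧ g ≤ w ∧
        (∀ x, emaximal d μ w x ≤ (4 * B : ℝ≥0) * w x) ∧ UnitBound μ p w (C * c) := by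
  have hB0 : 0 < B := zero_lt_one.trans_le hB1
  have hBE0 : (B : ℝ≥0∞) ≠ 0 := by exact_mod_cast hB0.ne'
  -- The quasi-norm may fail to be a norm, so `4 * B` replaces the usual `2 * B`: of the resulting
  -- `4^(-k)`, one factor `2^(-k)` sums the series pointwise and the other makes the modulars
  -- summable.
  set b : ℝ≥0∞ := ((4 * B : ℝ≥0) : ℝ≥0∞) with hb
  have hb0 : b ≠ 0 := by rw [hb]; exact_mod_cast (by positivity : (0 : ℝ≥0) < 4 * B).ne'
  have hbt : b ≠ ∞ := ENNReal.coe_ne_top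
  have hratio : (2⁻¹ : ℝ≥0∞) ^ (q : ℝ) < 1 :=
    ENNReal.rpow_lt_one (by simp) (by exact_mod_cast hq0)
  obtain ⟨S, hS⟩ : ∃ S : ℝ≥0, (S : ℝ≥0∞) = ∑' k : ℕ, ((2⁻¹ : ℝ≥0∞) ^ (q : ℝ)) ^ k := by
    refine ⟨_, ENNReal.coe_toNNReal ?_⟩
    rw [ENNReal.tsum_geometric]
    exact ENNReal.inv_ne_top.2 (tsub_pos_of_lt hratio).ne'
  set m : ℝ≥0 := max S 1 with hm
  have h1m : 1 ≤ m := le_max_right _ _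
  have hE : 1 ≤ m ^ (1 / (q : ℝ)) := NNReal.one_le_rpow h1m (by positivity)
  refine ⟨m ^ (1 / (q : ℝ)) * 2, one_le_mul hE one_le_two, fun g hg c hc hgc => ?_⟩
  have hcE0 : (c : ℝ≥0∞) ≠ 0 := by exact_mod_cast hc.ne'
  let F : ℕ → Ω → ℝ≥0∞ := fun k => (emaximal d μ)^[k] g
  have hFsucc : ∀ k, F (k + 1) = emaximal d μ (F k) := fun k =>
    Function.iterate_succ_apply' _ _ _
  have hFm : ∀ k, Measurable (F k) := fun k => by
    cases k with
    | zero => exact hg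
    | succ k => rw [hFsucc]; exact hΩ.measurable_emaximal _
  have hFB : ∀ k, UnitBound μ p (F k) (B ^ k * c) := fun k => by
    induction k with
    | zero => simpa [F] using hgc
    | succ k ih =>
      rw [hFsucc, pow_succ', mul_assoc]
      exact hB _ (hFm k) _ (by positivity) ih
  let w : Ω → ℝ≥0∞ := fun x => ∑' k, b⁻¹ ^ k * F k x
  have hwm : Measurable w := Measurable.tsum fun k => (hFm k).const_mul _
  have hgw : g ≤ w := fun x => by
    refine le_trans ?_ (ENNReal.le_tsum 0)
    simp [F]
  have hwA : ∀ x, emaximal d μ w x ≤ b * w x := fun x => by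
    refine emaximal_le fun z r hr hx => ?_
    rw [ENNReal.div_eq_inv_mul, lintegral_tsum fun k => ((hFm k).const_mul _).aemeasurable,
      ← ENNReal.tsum_mul_left, ← ENNReal.tsum_mul_left]
    -- The `k`-th term of `Mw` is compared with the term of index `k + 1` of `b w`; the term of
    -- index `0` is discarded.
    refine le_trans (ENNReal.tsum_le_tsum fun k => ?_)
      (ENNReal.tsum_comp_le_tsum_of_injective (add_left_injective 1) _)
    have h1 := le_emaximal (g := F k) (μ := μ) hr hx
    rw [← hFsucc, ENNReal.div_eq_inv_mul] at h1
    rw [lintegral_const_mul _ (hFm k)]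
    calc _ = b⁻¹ ^ k * ((μ (qball d z r))⁻¹ * ∫⁻ y in qball d z r, F k y ∂μ) := by ring
      _ ≤ b⁻¹ ^ k * F (k + 1) x := by gcongr
      _ = (b * b⁻¹) * (b⁻¹ ^ k * F (k + 1) x) := by
          rw [ENNReal.mul_inv_cancel hb0 hbt, one_mul]
      _ = b * (b⁻¹ ^ (k + 1) * F (k + 1) x) := by rw [pow_succ]; ring
  refine ⟨w, hwm, hgw, hwA, ?_⟩
  let u : ℕ → Ω → ℝ≥0∞ := fun k x => F k x / (B ^ k * c : ℝ≥0)
  -- A supremum commutes with any positive power and its power is at most the sum of the powers, so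
  -- no convexity in the exponent is needed.
  let V : Ω → ℝ≥0∞ := fun x => ⨆ k, (2⁻¹ : ℝ≥0∞) ^ k * u k x
  have hwV : ∀ x, w x / (2 * c : ℝ≥0) ≤ V x := fun x => by
    have h2c : 0 < 2 * c := by positivity
    rw [ENNReal.div_le_iff (by exact_mod_cast h2c.ne') ENNReal.coe_ne_top]
    have hterm : ∀ k, b⁻¹ ^ k * F k x ≤ (2⁻¹ : ℝ≥0∞) ^ k * (c * V x) := fun k => by
      have hFu : F k x = (B ^ k * c : ℝ≥0) * u k x := by
        have : 0 < B ^ k * c := by positivity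
        exact (ENNReal.mul_div_cancel (by exact_mod_cast this.ne') ENNReal.coe_ne_top).symm
      have hbB : b⁻¹ * B = 2⁻¹ * 2⁻¹ := by
        rw [hb, ENNReal.coe_mul, ENNReal.mul_inv (Or.inr ENNReal.coe_ne_top) (Or.inr hBE0),
          mul_assoc, ENNReal.inv_mul_cancel hBE0 ENNReal.coe_ne_top, mul_one,
          ← ENNReal.mul_inv (by simp) (by simp)]
        norm_num
      calc b⁻¹ ^ k * F k x = (b⁻¹ * B) ^ k * (c * u k x) := by
            rw [hFu, mul_pow]; push_cast; ring
        _ = (2⁻¹ : ℝ≥0∞) ^ k * (c * ((2⁻¹ : ℝ≥0∞) ^ k * u k x)) := by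
            rw [hbB, mul_pow]; ring
        _ ≤ _ := by gcongr; exact le_iSup (fun k => (2⁻¹ : ℝ≥0∞) ^ k * u k x) k
    calc w x ≤ ∑' k : ℕ, (2⁻¹ : ℝ≥0∞) ^ k * (c * V x) := ENNReal.tsum_le_tsum hterm
      _ = V x * (2 * c : ℝ≥0) := by
        rw [ENNReal.tsum_mul_right, ENNReal.tsum_geometric, ENNReal.one_sub_inv_two, inv_inv]
        push_cast; ring
  have hpm := hp.measurable
  rw [mul_assoc]
  refine unitBound_of_le (m := m) hp hq hq1 hE ?_ ?_ ?_
  · rw [← NNReal.rpow_mul, one_div, inv_mul_cancel₀ (by exact_mod_cast hq0.ne'), NNReal.rpow_one]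
  · calc ∫⁻ x in {x | p x ≠ ∞}, (w x / (2 * c : ℝ≥0)) ^ (p x).toReal ∂μ
        ≤ ∫⁻ x in {x | p x ≠ ∞}, ∑' k : ℕ,
            ((2⁻¹ : ℝ≥0∞) ^ (q : ℝ)) ^ k * u k x ^ (p x).toReal ∂μ := by
          refine lintegral_mono_ae ?_
          filter_upwards [ae_restrict_of_ae hq, ae_restrict_mem hp.measurableSet_ne_top]
            with x hx hpx
          have hqx : (q : ℝ) ≤ (p x).toReal := by simpa using ENNReal.toReal_mono hpx hx
          have hp0 := hp.toReal_pos hpx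
          calc (w x / (2 * c : ℝ≥0)) ^ (p x).toReal ≤ V x ^ (p x).toReal := by
                gcongr; exact hwV x
            _ = ⨆ k, ((2⁻¹ : ℝ≥0∞) ^ k * u k x) ^ (p x).toReal :=
                (ENNReal.orderIsoRpow _ hp0).map_iSup _
            _ ≤ _ := by
                refine iSup_le fun k => le_trans ?_ (ENNReal.le_tsum k)
                rw [ENNReal.mul_rpow_of_nonneg _ _ hp0.le, ← ENNReal.rpow_natCast,
                  ← ENNReal.rpow_natCast, ← ENNReal.rpow_mul, ← ENNReal.rpow_mul,
                  mul_comm (q : ℝ), ENNReal.rpow_mul, ENNReal.rpow_mul]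
                gcongr ?_ * _
                exact ENNReal.rpow_le_rpow_of_exponent_ge
                  (ENNReal.rpow_le_one (by simp) (by positivity)) hqx
      _ = ∑' k : ℕ, ((2⁻¹ : ℝ≥0∞) ^ (q : ℝ)) ^ k *
            ∫⁻ x in {x | p x ≠ ∞}, u k x ^ (p x).toReal ∂μ := by
          rw [lintegral_tsum fun k => by have := hFm k; fun_prop]
          exact tsum_congr fun k => lintegral_const_mul _ (by have := hFm k; fun_prop)
      _ ≤ ∑' k : ℕ, ((2⁻¹ : ℝ≥0∞) ^ (q : ℝ)) ^ k :=
          ENNReal.tsum_le_tsum fun k => mul_le_of_le_one_right' (hFB k).1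
      _ ≤ m := by rw [← hS]; exact_mod_cast le_max_left S 1
  · filter_upwards [ae_all_iff.2 fun k => (hFB k).2] with x hx hpx
    have hV : V x ≤ 1 := iSup_le fun k => by
      have hu : u k x ≤ 1 := ENNReal.div_le_of_le_mul (by rw [one_mul]; exact hx k hpx)
      exact mul_le_one' (pow_le_one₀ zero_le (by simp)) hu
    have h1 := (hwV x).trans hV
    have h2c : 0 < 2 * c := by positivity
    rw [ENNReal.div_le_iff (by exact_mod_cast h2c.ne') ENNReal.coe_ne_top] at h1
    refine h1.trans ?_
    gcongr
    exact_mod_cast h1m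

lemma UnitBound.const_mul {g : Ω → ℝ≥0∞} {c : ℝ≥0} (hg : UnitBound μ p g c) {a : ℝ≥0}
    (ha : 0 < a) : UnitBound μ p (fun x => a * g x) (a * c) := by
  have ha' : (a : ℝ≥0∞) ≠ 0 := by exact_mod_cast ha.ne'
  refine ⟨?_, ?_⟩
  · simp_rw [ENNReal.coe_mul, ENNReal.mul_div_mul_left _ _ ha' ENNReal.coe_ne_top]
    exact hg.1
  · filter_upwards [hg.2] with x hx hpx
    rw [ENNReal.coe_mul]
    gcongr
    exact hx hpx

/-- Quantitative self-improvement of the boundedness of the maximal operator. -/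
theorem IsHomogeneousType.exists_boundedWith_scale (hΩ : IsHomogeneousType d μ) :
    ∃ ε : ℝ, 0 < ε ∧ ∀ (p : Ω → ℝ≥0∞) (q B : ℝ≥0), IsExponent p →
      (∀ᵐ x ∂μ, (q : ℝ≥0∞) ≤ p x) → 0 < q → q ≤ 1 → 1 ≤ B → BoundedWith d μ p B →
      ∀ δ : ℝ, 0 < δ → δ * (4 * B : ℝ≥0) ≤ ε →
        ∃ C : ℝ≥0, 1 ≤ C ∧ BoundedWith d μ (scale (1 / (1 + δ)) p) C := by
  obtain ⟨ε, hε, H⟩ := hΩ.exists_emaximal_rpow_le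
  -- `ε` is fixed before `p`, `q` and `B`, so one value serves all the exponents `s p` at once.
  refine ⟨ε, hε, fun p q B hp hq hq0 hq1 hB1 hB δ hδ hδε => ?_⟩
  have h4B : 1 ≤ 4 * B := one_le_mul (by norm_num) hB1
  obtain ⟨C₁, hC₁, H₁⟩ := H (4 * B) h4B δ hδ hδε
  obtain ⟨C₂, hC₂, H₂⟩ := hΩ.exists_A1_majorant hp hq hq0 hq1 hB1 hB
  have h1δ : 0 < 1 + δ := by positivity
  refine ⟨C₁ * C₂ ^ (1 + δ), one_le_mul hC₁ (NNReal.one_le_rpow hC₂ h1δ.le),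
    fun h hh c hc hhc => ?_⟩
  have hpp : scale (1 + δ) (scale (1 / (1 + δ)) p) = p := by
    rw [scale_scale h1δ.le, mul_one_div_cancel h1δ.ne']
    funext x
    simp [scale]
  have hroot : ∀ a : ℝ≥0∞, (a ^ (1 + δ)⁻¹) ^ (1 + δ) = a := fun a =>
    ENNReal.rpow_inv_rpow h1δ.ne' a
  have hg : UnitBound μ p (fun x => h x ^ (1 + δ)⁻¹) (c ^ (1 + δ)⁻¹) := by
    rw [← hpp, unitBound_scale_iff h1δ]
    simp_rw [hroot]
    rwa [NNReal.rpow_inv_rpow h1δ.ne']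
  obtain ⟨w, hwm, hgw, hwA, hw⟩ := H₂ _ (hh.pow_const _) _ (NNReal.rpow_pos hc) hg
  rw [← hpp, unitBound_scale_iff h1δ, NNReal.mul_rpow, NNReal.rpow_inv_rpow h1δ.ne'] at hw
  rw [mul_assoc]
  refine (hw.const_mul (zero_lt_one.trans_le hC₁)).mono_ae (Eventually.of_forall fun x => ?_)
  refine (emaximal_mono_ae (Eventually.of_forall fun y => ?_) x).trans (H₁ w hwm hwA x)
  calc h y = (h y ^ (1 + δ)⁻¹) ^ (1 + δ) := (hroot _).symm
    _ ≤ w y ^ (1 + δ) := by gcongr; exact hgw y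

lemma ae_le_scale (hq : ∀ᵐ x ∂μ, (q : ℝ≥0∞) ≤ p x) (s : ℝ) :
    ∀ᵐ x ∂μ, ((s.toNNReal * q : ℝ≥0) : ℝ≥0∞) ≤ scale s p x := by
  filter_upwards [hq] with x hx
  rw [ENNReal.coe_mul, scale, ENNReal.ofReal]
  gcongr

lemma ae_le_scale_of_one_le (hq : ∀ᵐ x ∂μ, (q : ℝ≥0∞) ≤ p x) {s : ℝ} (hs : 1 ≤ s) :
    ∀ᵐ x ∂μ, (q : ℝ≥0∞) ≤ scale s p x := by
  filter_upwards [hq] with x hx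
  exact hx.trans (le_mul_of_one_le_left zero_le (ENNReal.one_le_ofReal.2 hs))

/-- If the norms of the maximal operator on the spaces with exponents `s p` grow more slowly than
`(s - 1)⁻¹`, then the maximal operator is bounded for some exponent below `p`. -/
theorem IsHomogeneousType.exists_boundedWith_of_tendsto (hΩ : IsHomogeneousType d μ)
    (hp : IsExponent p) (hq : ∀ᵐ x ∂μ, (q : ℝ≥0∞) ≤ p x) (hq0 : 0 < q) (hq1 : q ≤ 1)
    (hb : ∀ s : ℝ, 1 < s → MaximalBounded d μ (scale s p))
    (hlim : Tendsto (fun s : ℝ => ENNReal.ofReal (s - 1) * maximalNorm d μ (scale s p))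
      (𝓝[>] 1) (𝓝 0)) :
    ∃ r₀ ∈ Set.Ioo (0 : ℝ) 1, ∃ C : ℝ≥0, 1 ≤ C ∧ BoundedWith d μ (scale r₀ p) C := by
  obtain ⟨ε, hε, H⟩ := hΩ.exists_boundedWith_scale
  set D : ℝ≥0 := 2 ^ (1 / (q : ℝ)) with hD
  have hD1 : 1 ≤ D := one_le_two_rpow
  have hD0 : (0 : ℝ) < D := zero_lt_one.trans_le hD1
  -- The goal is `s - 1 < ε / (4 B)` with `B = N D + 1`. This threshold makes `4 (s - 1) N D` less
  -- than `ε / 2`, and `hnear` does the same for the summand `1`.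
  have hη : 0 < ENNReal.ofReal (ε / (8 * D)) := ENNReal.ofReal_pos.2 (by positivity)
  have hnear : ∀ᶠ s : ℝ in 𝓝[>] 1, s < 1 + ε / 8 :=
    mem_nhdsWithin_of_mem_nhds (Iio_mem_nhds (by linarith))
  have hright : ∀ᶠ s : ℝ in 𝓝[>] 1, 1 < s := self_mem_nhdsWithin
  obtain ⟨s, hs1, hsη, hsε⟩ :=
    (hright.and ((hlim.eventually (gt_mem_nhds hη)).and hnear)).exists
  have hs0 : 0 < s := by linarith
  obtain ⟨N₀, hN₀⟩ := (hb s hs1).exists_maximalNorm_le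
  obtain ⟨N, hN⟩ : ∃ N : ℝ≥0, (N : ℝ≥0∞) = maximalNorm d μ (scale s p) :=
    ⟨_, ENNReal.coe_toNNReal (hN₀.trans_lt ENNReal.coe_lt_top).ne⟩
  rw [← hN, ← ENNReal.ofReal_coe_nnreal, ← ENNReal.ofReal_mul (by linarith),
    ENNReal.ofReal_lt_ofReal_iff (by positivity), lt_div_iff₀ (by positivity)] at hsη
  have hsp := hp.scale hs0
  have hsq := ae_le_scale_of_one_le hq hs1.le
  have hB := boundedWith_of_maximalNorm_le hsp hsq hq0 hq1 hN.ge
  set B : ℝ≥0 := N * D + 1 with hBdef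
  have hB1 : 1 ≤ B := le_add_self
  have h4B : (0 : ℝ) < (4 * B : ℝ≥0) := by positivity
  have hδ : 0 < ε / (4 * B : ℝ≥0) := by positivity
  obtain ⟨C, hC1, hC⟩ := H _ q B hsp hsq hq0 hq1 hB1 hB _ hδ
    (by rw [div_mul_cancel₀ _ h4B.ne'])
  rw [scale_scale (by positivity)] at hC
  -- The witness is `s / (1 + δ)` with `δ = ε / (4 B)`.
  refine ⟨_, ⟨by positivity, ?_⟩, C, hC1, hC⟩
  rw [one_div, inv_mul_lt_iff₀ (by positivity), mul_one, ← sub_lt_iff_lt_add',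
    lt_div_iff₀ h4B]
  rw [hBdef]
  push_cast
  linarith

end HomogeneousType

/-! ### The equivalences. -/

open HomogeneousType

theorem corollary4p5 {Ω : Type*} [MeasurableSpace Ω] (d : Ω → Ω → ℝ) (μ : Measure Ω)
    (hΩ : IsHomogeneousType d μ) (p : Ω → ℝ≥0∞) (hp : IsExponent p) (hp_inf : 0 < essInf p μ) :
    List.TFAE [
      MaximalBounded d μ p,
      (∀ s : ℝ, 1 < s → MaximalBounded d μ (scale s p)) ∧
        Tendsto (fun s : ℝ => ENNReal.ofReal (s - 1) * maximalNorm d μ (scale s p))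
          (𝓝[>] 1) (𝓝 0),
      ∃ r₀ : ℝ, r₀ ∈ Set.Ioo (0 : ℝ) 1 ∧
        ∀ r ∈ Set.Ico r₀ 1, MaximalBounded d μ (scale r p)] := by
  -- Capping at `1` keeps `q` finite even if `p` is infinite almost everywhere, and gives the `q ≤
  -- 1` required by the modular estimates.
  obtain ⟨q, hq0, hqp⟩ := ENNReal.lt_iff_exists_nnreal_btwn.1 (lt_min hp_inf zero_lt_one)
  replace hq0 : 0 < q := by exact_mod_cast hq0
  have hq1 : q ≤ 1 := by exact_mod_cast (hqp.trans_le (min_le_right _ _)).le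
  have hq : ∀ᵐ x ∂μ, (q : ℝ≥0∞) ≤ p x := by
    filter_upwards [ae_essInf_le (f := p) (μ := μ)] with x hx
    exact (hqp.trans_le (min_le_left _ _)).le.trans hx
  have hfin := hΩ.measure_qball
  tfae_have 1 → 2 := by
    intro h
    obtain ⟨B, hB1, hB⟩ := (maximalBounded_iff hp hq hq0 hq1).1 h
    have key := fun (s : ℝ) (hs : 1 < s) =>
      (hB.scale hfin hB1 hs.le).maximalBounded (hp.scale (zero_lt_one.trans hs))
        (ae_le_scale_of_one_le hq hs.le) hq0 hq1 (zero_lt_one.trans_le hB1)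
    refine ⟨fun s hs => (key s hs).1, ?_⟩
    have hlim : Tendsto (fun s : ℝ => ENNReal.ofReal (s - 1) * (2 ^ (1 / (q : ℝ)) * B : ℝ≥0))
        (𝓝[>] 1) (𝓝 0) := by
      have h1 : Tendsto (fun s : ℝ => ENNReal.ofReal (s - 1)) (𝓝[>] 1) (𝓝 0) := by
        have : Tendsto (fun s : ℝ => ENNReal.ofReal (s - 1)) (𝓝 1) (𝓝 (ENNReal.ofReal (1 - 1))) :=
          (ENNReal.continuous_ofReal.comp (continuous_id.sub continuous_const)).tendsto 1
        rw [sub_self, ENNReal.ofReal_zero] at this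
        exact this.mono_left nhdsWithin_le_nhds
      simpa only [zero_mul] using ENNReal.Tendsto.mul_const h1 (Or.inr ENNReal.coe_ne_top)
    refine tendsto_of_tendsto_of_tendsto_of_le_of_le' tendsto_const_nhds hlim
      (Eventually.of_forall fun _ => zero_le) ?_
    filter_upwards [self_mem_nhdsWithin] with s hs
    gcongr
    exact (key s hs).2
  tfae_have 2 → 3 := by
    rintro ⟨hb, hlim⟩
    obtain ⟨r₀, hr₀, C, hC1, hC⟩ := hΩ.exists_boundedWith_of_tendsto hp hq hq0 hq1 hb hlim
    refine ⟨r₀, hr₀, fun r hr => ?_⟩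
    have hr0 : 0 < r := hr₀.1.trans_le hr.1
    have hscale : scale (r / r₀) (scale r₀ p) = scale r p := by
      rw [scale_scale (div_nonneg hr0.le hr₀.1.le), div_mul_cancel₀ _ hr₀.1.ne']
    -- Every `r ≥ r₀` is reached from `r₀` by a factor `r / r₀ ≥ 1`, so one exponent below `p`
    -- yields the whole range.
    have hCr := hC.scale hfin hC1 ((one_le_div hr₀.1).2 hr.1)
    rw [hscale] at hCr
    exact (hCr.maximalBounded (hp.scale hr0) (ae_le_scale hq r)
      (mul_pos (Real.toNNReal_pos.2 hr0) hq0)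
      (mul_le_one' (Real.toNNReal_le_one.2 hr.2.le) hq1) (zero_lt_one.trans_le hC1)).1
  tfae_have 3 → 1 := by
    rintro ⟨r₀, hr₀, h⟩
    obtain ⟨B, hB1, hB⟩ := (maximalBounded_iff (hp.scale hr₀.1) (ae_le_scale hq r₀)
      (mul_pos (Real.toNNReal_pos.2 hr₀.1) hq0)
      (mul_le_one' (Real.toNNReal_le_one.2 hr₀.2.le) hq1)).1 (h r₀ ⟨le_rfl, hr₀.2⟩)
    refine (maximalBounded_iff hp hq hq0 hq1).2 ⟨B, hB1, ?_⟩
    have hBr := hB.scale hfin hB1 ((one_le_inv₀ hr₀.1).2 hr₀.2.le)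
    have hscale : scale r₀⁻¹ (scale r₀ p) = p := by
      rw [scale_scale (inv_nonneg.2 hr₀.1.le), inv_mul_cancel₀ hr₀.1.ne']
      funext x
      simp [scale]
    rwa [hscale] at hBr
  tfae_finish
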